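/- **Setting.** Let $N>1$ be an odd composite integer that is not a perfect square, let $R^{+}(N)=\ln(x+y\sqrt N)$, where $(x,y)$ is the minimal positive solution of $X^2-NY^2=1$, and assume $R^{+}(N)>(\ln N)^2$. Let $\tau$ be the period of the continued fraction of $\sqrt N$ and put $\mathrm{dist}(N)=R^{+}(N)/2$ if $\tau$ is even, $\mathrm{dist}(N)=R^{+}(N)/4$ if $\tau$ is odd. Put $P_0=0$, $Q_0=1$, $a_m=\lfloor (P_m+\sqrt N)/Q_m\rfloor$, $P_{m+1}=a_mQ_m-P_m$, $Q_{m+1}=(N-P_{m+1}^2)/Q_m$, and let $\Upsilon_m=(-1)^mQ_mX^2+2P_{m+1}XY+(-1)^{m+1}Q_{m+1}Y^2$, a form of discriminant $\Delta=4N$. A form $(a,b,c)=aX^2+bXY+cY^2$ of discriminant $\Delta$ is reduced if $|\sqrt\Delta-2|a||<b<\sqrt\Delta$. The reduction operator is $\rho(a,b,c)=(c,r,(r^2-\Delta)/(4c))$, where $r$ is the integer with $r\equiv -b \pmod{2c}$ and $-|c|<r\le|c|$ if $\sqrt\Delta<|c|$, and $\sqrt\Delta-2|c|<r<\sqrt\Delta$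 if $|c|<\sqrt\Delta$. For $F=(a,b,c)$ let $\delta(F,\rho(F))=\frac12\ln\left|\frac{b+\sqrt\Delta}{b-\sqrt\Delta}\right|$ and $\delta(F,\rho^n(F))=\sum_{i=1}^{n}\delta(\rho^{i-1}(F),\rho^i(F))$. The Gauss composition of $(a_1,b_1,c_1)$ and $(a_2,b_2,c_2)$ is $(a_3,b_3,c_3)$ with $a_3=d\,a_1a_2/n^2$, $b_3=b_1+\frac{2a_1}{n}\left(\frac{s(b_2-b_1)}{2}-c_1v\right)$, $c_3=(b_3^2-\Delta)/(4a_3)$, where $\beta=(b_1+b_2)/2$, $n=\gcd(a_1,a_2,\beta)=a_1s+a_2u+\beta v$, $d=\gcd(a_1,a_2,\beta,c_1,c_2,(b_1-b_2)/2)$; the Bézout coefficients $s,u,v$ may be chosen arbitrarily at every composition. **The giant steps.** Let $\ell$ be least with $\delta(\Upsilon_0,\rho^{\ell}(\Upsilon_0))\ge 2\ln(4N)+1$, and let $G_0=\rho^\ell(\Upsilon_0)$, $d_0=\delta(\Upsilon_0,\rho^{\ell}(\Upsilon_0))$. For $i\ge 0$ let $H=G_i\circ G_i$, let $r$ be the least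 integer $\ge 0$ for which $\rho^r(H)$ is reduced, and put $G_{i+1}=\rho^r(H)$, $d_{i+1}=2d_i+\delta(H,\rho^r(H))$. For a target $D$ let $t=t(D)$ be the number of passes of the loop "while $d_i\le D$, compute $(G_{i+1},d_{i+1})$", that is, the least $i$ with $d_i>D$. **Proposition.** 1. The number $\ell$ exists. For every $i\ge0$ the form $G_i$ is reduced and there is $k\ge 0$ with $G_i=\Upsilon_k=\rho^k(\Upsilon_0)$ and $d_i=\delta(\Upsilon_0,\rho^k(\Upsilon_0))$; that is, $d_i=\delta(\Upsilon_0,G_i)$, counted with the number of turns around the principal cycle. Moreover $d_0\ge 1+2\ln(4N)$, and $\delta(\Upsilon_0,G_i)=d_i>2^i+2\ln(4N)$ for all $i\ge1$. 2. For $D=\mathrm{dist}(N)$, and also for each of the two values $D=R^{+}(N)/2$ and $D=R^{+}(N)/4$ (irrespective of the parity of $\tau$), the loop stops and $t(D)\le\lceil\log_2 D\rceil$. In particular $t\le\lceil\log_2\mathrm{dist}(N)\rceil$. 3. There is an absolute constant $C$ such that $t(D)\le C\ln N$ for all such $N$ and $D$ and all choices of Bézout coefficients; that is, $t=O(\ln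 N)$. Statements 2 and 3 hold as well if the loop is started instead with $G_0=\rho^{\ell'}(\Upsilon_0)$ and $d_0=\delta(\Upsilon_0,\rho^{\ell'+1}(\Upsilon_0))$, where $\ell'\ge 0$ is least (it exists) with $\delta(\Upsilon_0,\rho^{\ell'+1}(\Upsilon_0))\ge 2\ln(4N)+1$. -/

import Mathlib

/-- An integral binary quadratic form `a X² + b X Y + c Y²`. -/
@[ext]
structure BinForm where
  a : ℤ
  b : ℤ
  c : ℤ

namespace BinForm

/-- The discriminant `b² - 4ac`. -/
def disc (F : BinForm) : ℤ := F.b ^ 2 - 4 * F.a * F.c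

/-- A form of positive discriminant `Δ` is reduced if `|√Δ - 2|a|| < b < √Δ`. -/
def IsReduced (F : BinForm) : Prop :=
  |√(F.disc : ℝ) - 2 * abs (F.a : ℝ)| < (F.b : ℝ) ∧ (F.b : ℝ) < √(F.disc : ℝ)

/-- The residue `r(-b, c)`: the integer `r ≡ -b (mod 2c)` with `-|c| < r ≤ |c|` if `√Δ < |c|`,
and with `√Δ - 2|c| < r < √Δ` if `|c| < √Δ`; see `redResidue_spec` and `redResidue_unique`. -/
def redResidue (Δ b c : ℤ) : ℤ :=
  -b + 2 * |c| * (((if Δ < c ^ 2 then |c| else Int.sqrt Δ) + b) / (2 * |c|))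

/-- The defining property of `r(-b, c)`. -/
def IsRedResidue (Δ b c r : ℤ) : Prop :=
  2 * c ∣ r + b ∧
    (√(Δ : ℝ) < |(c : ℝ)| → -|c| < r ∧ r ≤ |c|) ∧
    (|(c : ℝ)| < √(Δ : ℝ) → √(Δ : ℝ) - 2 * |(c : ℝ)| < (r : ℝ) ∧ (r : ℝ) < √(Δ : ℝ))

theorem redResidue_spec (Δ b c : ℤ) (hc : c ≠ 0) (hΔ : 0 < Δ) (hsq : ¬ IsSquare Δ) :
    IsRedResidue Δ b c (redResidue Δ b c) := by
  have hc' : 0 < |c| := abs_pos.mpr hc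
  have hdvd : 2 * c ∣ redResidue Δ b c + b := by
    unfold redResidue
    rw [show ∀ x y : ℤ, -b + 2 * |c| * x + b = 2 * |c| * x from fun x _ => by ring]
    · exact Dvd.dvd.mul_right (mul_dvd_mul_left 2 (self_dvd_abs c)) _
    · exact 0
  have key : ∀ M : ℤ, M - 2 * |c| < -b + 2 * |c| * ((M + b) / (2 * |c|)) ∧
      -b + 2 * |c| * ((M + b) / (2 * |c|)) ≤ M := by
    intro M
    have h1 := Int.emod_add_mul_ediv (M + b) (2 * |c|)
    have h2 := Int.emod_nonneg (M + b) (b := 2 * |c|) (by positivity)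
    have h3 := Int.emod_lt_of_pos (M + b) (b := 2 * |c|) (by positivity)
    constructor <;> linarith
  refine ⟨hdvd, fun h => ?_, fun h => ?_⟩
  · have hlt : Δ < c ^ 2 := by
      have h1 := (Real.sqrt_lt' (by positivity)).mp h
      rw [sq_abs] at h1
      exact_mod_cast h1
    have := key |c|
    unfold redResidue
    rw [if_pos hlt]
    constructor <;> linarith [this.1, this.2]
  · have hlt : ¬ Δ < c ^ 2 := by
      have h1 := (Real.lt_sqrt (abs_nonneg _)).mp h
      rw [sq_abs] at h1
      have h2 : c ^ 2 < Δ := by exact_mod_cast h1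
      omega
    have hk := key (Int.sqrt Δ)
    unfold redResidue
    rw [if_neg hlt]
    obtain ⟨n, rfl⟩ : ∃ n : ℕ, Δ = n := ⟨Δ.toNat, by omega⟩
    have hs : Int.sqrt (n : ℤ) = (Nat.sqrt n : ℤ) := by simp [Int.sqrt]
    rw [hs] at hk ⊢
    have hle : (Nat.sqrt n : ℝ) < √((n : ℤ) : ℝ) := by
      refine Real.lt_sqrt_of_sq_lt ?_
      have h1 : Nat.sqrt n ^ 2 ≤ n := Nat.sqrt_le' n
      have h2 : Nat.sqrt n ^ 2 ≠ n := by
        intro h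
        exact hsq ⟨(Nat.sqrt n : ℤ), by rw [← pow_two]; exact_mod_cast h.symm⟩
      exact_mod_cast lt_of_le_of_ne h1 h2
    have hge : √((n : ℤ) : ℝ) < (Nat.sqrt n : ℝ) + 1 := by
      rw [Real.sqrt_lt' (by positivity)]
      exact_mod_cast Nat.lt_succ_sqrt' n
    set r := -b + 2 * |c| * (((Nat.sqrt n : ℤ) + b) / (2 * |c|)) with hr
    have h1 : ((Nat.sqrt n : ℤ) : ℝ) - 2 * |(c : ℝ)| + 1 ≤ (r : ℝ) := by
      have : (Nat.sqrt n : ℤ) - 2 * |c| + 1 ≤ r := by linarith [hk.1]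
      exact_mod_cast this
    have h2 : (r : ℝ) ≤ ((Nat.sqrt n : ℤ) : ℝ) := by exact_mod_cast hk.2
    push_cast at h1 h2 hle hge ⊢
    constructor <;> linarith

theorem redResidue_unique (Δ b c r : ℤ) (hc : c ≠ 0) (hΔ : 0 < Δ) (hsq : ¬ IsSquare Δ)
    (hr : IsRedResidue Δ b c r) : r = redResidue Δ b c := by
  have hs := redResidue_spec Δ b c hc hΔ hsq
  set s := redResidue Δ b c
  have hd : 2 * |c| ∣ r - s := by
    have h : 2 * c ∣ r - s := by
      have := dvd_sub hr.1 hs.1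
      rwa [add_sub_add_right_eq_sub] at this
    rcases abs_choice c with h' | h' <;> rw [h']
    · exact h
    · rw [mul_neg]; exact (neg_dvd).mpr h
  have hlt : |r - s| < 2 * |c| := by
    rcases lt_trichotomy (√(Δ : ℝ)) |(c : ℝ)| with h | h | h
    · have h1 := hr.2.1 h
      have h2 := hs.2.1 h
      rw [abs_lt]; constructor <;> linarith [h1.1, h1.2, h2.1, h2.2]
    · exfalso
      apply hsq
      have h1 : (Δ : ℝ) = (c : ℝ) ^ 2 := by
        rw [← sq_abs, ← h, Real.sq_sqrt (by exact_mod_cast hΔ.le)]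
      exact ⟨c, by rw [← pow_two]; exact_mod_cast h1⟩
    · have h1 := hr.2.2 h
      have h2 := hs.2.2 h
      have : |(r : ℝ) - s| < 2 * |(c : ℝ)| := by
        rw [abs_lt]; constructor <;> linarith [h1.1, h1.2, h2.1, h2.2]
      exact_mod_cast this
  have := Int.eq_zero_of_abs_lt_dvd hd hlt
  omega

/-- The standard reduction operator `ρ(a, b, c) = (c, r, (r² - Δ) / (4c))`, `r = r(-b, c)`. -/
def rho (F : BinForm) : BinForm where
  a := F.c
  b := redResidue F.disc F.b F.c
  c := (redResidue F.disc F.b F.c ^ 2 - F.disc) / (4 * F.c)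

/-- `δ(F, ρ(F)) = (1/2) ln |(b + √Δ) / (b - √Δ)|`. -/
noncomputable def stepDist (F : BinForm) : ℝ :=
  1 / 2 * Real.log |((F.b : ℝ) + √(F.disc : ℝ)) / ((F.b : ℝ) - √(F.disc : ℝ))|

/-- The infrastructural distance `δ(F, ρⁿ(F))`. -/
noncomputable def infraDist (F : BinForm) (n : ℕ) : ℝ :=
  ∑ i ∈ Finset.range n, stepDist (rho^[i] F)

/-- The number of iterations of `ρ` made by the loop `while F is not reduced do F ← ρ(F)`. -/
noncomputable def redCount (F : BinForm) : ℕ := sInf {r | IsReduced (rho^[r] F)}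

/-- The number `β = (b₁ + b₂) / 2` of two forms of the same discriminant. -/
def beta (F G : BinForm) : ℤ := (F.b + G.b) / 2

/-- The Gauss composition `F ∘ G` of two forms of the same discriminant, computed with
the Bézout coefficients `w = (s, u, v)`, where `a₁ s + a₂ u + β v = n = gcd(a₁, a₂, β)`. -/
def gaussComp (F G : BinForm) (w : ℤ × ℤ × ℤ) : BinForm :=
  let n : ℤ := Int.gcd F.a (Int.gcd G.a (beta F G))
  let d₀ : ℤ := Int.gcd n (Int.gcd F.c (Int.gcd G.c ((F.b - G.b) / 2)))
  let a₃ : ℤ := d₀ * F.a * G.a / n ^ 2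
  let b₃ : ℤ := F.b + 2 * F.a / n * (w.1 * ((G.b - F.b) / 2) - F.c * w.2.2)
  ⟨a₃, b₃, (b₃ ^ 2 - F.disc) / (4 * a₃)⟩

end BinForm

/-- The pair `(P_m, Q_m)` of the continued fraction algorithm for `√N`: `P₀ = 0`, `Q₀ = 1`,
`P_{m+1} = a_m Q_m - P_m`, `Q_{m+1} = (N - P_{m+1}²) / Q_m`, `a_m = ⌊(P_m + √N) / Q_m⌋`. -/
noncomputable def cfPQ (N : ℕ) : ℕ → ℤ × ℤ
  | 0 => (0, 1)
  | m + 1 =>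
    let P := ⌊(((cfPQ N m).1 : ℝ) + √(N : ℝ)) / ((cfPQ N m).2 : ℝ)⌋ * (cfPQ N m).2 - (cfPQ N m).1
    (P, ((N : ℤ) - P ^ 2) / (cfPQ N m).2)

/-- The partial quotients `a_m` of `√N`. -/
noncomputable def cfA (N m : ℕ) : ℤ :=
  ⌊(((cfPQ N m).1 : ℝ) + √(N : ℝ)) / ((cfPQ N m).2 : ℝ)⌋

/-- The period `τ` of the continued fraction expansion of `√N`. -/
noncomputable def cfPeriod (N : ℕ) : ℕ :=
  sInf {k | 0 < k ∧ ∀ m, 1 ≤ m → cfA N (m + k) = cfA N m}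

/-- The form `Υ_m = (-1)^m Q_m X² + 2 P_{m+1} X Y + (-1)^(m+1) Q_{m+1} Y²`. -/
noncomputable def upsilon (N m : ℕ) : BinForm :=
  ⟨(-1) ^ m * (cfPQ N m).2, 2 * (cfPQ N (m + 1)).1, (-1) ^ (m + 1) * (cfPQ N (m + 1)).2⟩

open Classical in
/-- `R⁺(N) = ln (x + y √N)`, where `(x, y)` is the minimal positive solution of
`x² - N y² = 1` (which exists whenever `N` is positive and not a square). -/
noncomputable def regPlus (N : ℕ) : ℝ :=
  if h : ∃ e : Pell.Solution₁ (N : ℤ), Pell.IsFundamental e then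
    Real.log ((h.choose.x : ℝ) + (h.choose.y : ℝ) * √(N : ℝ))
  else 0

/-- The target distance: `R⁺(N)/2` if `τ` is even, `R⁺(N)/4` if `τ` is odd. -/
noncomputable def targetDist (N : ℕ) : ℝ :=
  if Even (cfPeriod N) then regPlus N / 2 else regPlus N / 4

/-- A rule that returns Bézout coefficients `(s, u, v)` with `x s + y u + z v = gcd(x, y, z)`.
The first argument is the number of the giant step, so that the rule may return different
coefficients for the same `x, y, z` in different steps. -/
def IsBezoutRule (bez : ℕ → ℤ → ℤ → ℤ → ℤ × ℤ × ℤ) : Prop :=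
  ∀ (i : ℕ) (x y z : ℤ),
    x * (bez i x y z).1 + y * (bez i x y z).2.1 + z * (bez i x y z).2.2
      = (Int.gcd x (Int.gcd y z) : ℤ)

/-- One pass of the squaring loop, from `(G_i, d_i)` to `(G_{i+1}, d_{i+1})`: compose `G_i` with
itself, set `d = 2 d_i`, and while the form is not reduced, add the distance of the next
reduction step to `d` and apply `ρ`. -/
noncomputable def giantSquare (w : ℤ × ℤ × ℤ) (S : BinForm × ℝ) : BinForm × ℝ :=
  let H := BinForm.gaussComp S.1 S.1 w
  (BinForm.rho^[H.redCount] H, 2 * S.2 + H.infraDist H.redCount)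

/-- The states `(G_i, d_i)` of the squaring loop started in the state `S₀ = (G₀, d₀)`. -/
noncomputable def giantState (bez : ℕ → ℤ → ℤ → ℤ → ℤ × ℤ × ℤ) (S₀ : BinForm × ℝ) :
    ℕ → BinForm × ℝ
  | 0 => S₀
  | i + 1 =>
    let S := giantState bez S₀ i
    giantSquare (bez i S.1.a S.1.a (BinForm.beta S.1 S.1)) S

/-- The initial state `(G₀, d₀) = (Υ_ℓ, δ(Υ₀, Υ_ℓ))`, where `ℓ` is the number of baby steps `ρ`
needed until `δ(Υ₀, Υ_ℓ) ≥ 2 ln(4N) + 1`. -/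
noncomputable def startState (N : ℕ) : BinForm × ℝ :=
  let ℓ := sInf {k | 2 * Real.log (4 * N) + 1 ≤ (upsilon N 0).infraDist k}
  (BinForm.rho^[ℓ] (upsilon N 0), (upsilon N 0).infraDist ℓ)

/-- The initial state produced by the loop that starts with `G₀ = Υ₀`, `d₀ = δ(Υ₀, Υ₁)` and, while
`d₀ < 2 ln(4N) + 1`, replaces `G₀` by `ρ(G₀)` and then adds `δ(G₀, ρ(G₀))`, for the new `G₀`,
to `d₀`. Here `d₀` is always the distance of the form that follows `G₀`. -/
noncomputable def startStateAhead (N : ℕ) : BinForm × ℝ :=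
  let ℓ := sInf {k | 2 * Real.log (4 * N) + 1 ≤ (upsilon N 0).infraDist (k + 1)}
  (BinForm.rho^[ℓ] (upsilon N 0), (upsilon N 0).infraDist (ℓ + 1))

/-- The number `t` of passes of the loop `while d_i ≤ D`, that is, the least `i` with `D < d_i`. -/
noncomputable def giantCount (bez : ℕ → ℤ → ℤ → ℤ → ℤ × ℤ × ℤ) (S₀ : BinForm × ℝ) (D : ℝ) : ℕ :=
  sInf {i | D < (giantState bez S₀ i).2}

/-- The inputs of the algorithm: `N` is odd, composite, not a square, and `R⁺(N) > (ln N)²`. -/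
def IsInput (N : ℕ) : Prop :=
  1 < N ∧ Odd N ∧ ¬ N.Prime ∧ ¬ IsSquare N ∧ Real.log N ^ 2 < regPlus N

/-! The forms are realised as norm forms `N(αX + βY)` for oriented bases `(α, β)` of `ℤ√N`, and
distance is read off from `logRatio α`, half the logarithm of the ratio of the conjugates of `α`.
The operator `ρ` replaces `(α, β)` by `(β, kβ - α)` and costs `logRatio β - logRatio α`, so
distances telescope (`IsNormBasis.stepDist_eq`, `IsNormBasis.iterate_rho`). Composing a form with
itself replaces `α` by `α²/n`, so `logRatio` doubles exactly (`IsNormBasis.gaussComp_self`). Hence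
`d_i` equals the `logRatio` of a basis of `G_i` whenever this holds at the start.

Growth: reducing the square can lose at most `log (2|a| + 2√N)`, which is below `2 log (4N)` because
`G_i` is reduced (`IsNormBasis.neg_log_le_infraDist`). So `d_i - 2 log (4N)` more than doubles at
each pass. This needs only a lower bound for `d_0`, and therefore covers both starting states.

Position on the cycle: the basis elements of a reduced form are neighbouring minima of the lattice,
so a reduced form whose `logRatio` lies between the distances of `Υ_k` and `Υ_{k+1}` must be `Υ_k`
(`IsNormBasis.eq_of_logRatio_mem`). These distances are unbounded, so they partition `[0, ∞)`, and
the index `k` also records the turns around the cycle.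

Logarithmic bound: by pigeonhole two forms `Υ_i = Υ_j` coincide with `j = O(N²)`. Their bases differ
by a unit of norm one, so `R⁺(N)` is polynomially bounded in `N` (`regPlus_le`). -/

/-! ### Real embeddings of `ℤ√N` and the logarithmic ratio. -/

/-- The real embedding of `ℤ√N` that sends `√N` to the positive root. -/
noncomputable def qEmb {N : ℕ} (α : ℤ√(N : ℤ)) : ℝ := α.re + α.im * √(N : ℝ)

/-- The real embedding of `ℤ√N` that sends `√N` to the negative root. -/
noncomputable def qConj {N : ℕ} (α : ℤ√(N : ℤ)) : ℝ := α.re - α.im * √(N : ℝ)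

/-- Half the logarithm of the ratio of the absolute values of the two conjugates. -/
noncomputable def logRatio {N : ℕ} (α : ℤ√(N : ℤ)) : ℝ := 1 / 2 * Real.log |qEmb α / qConj α|

theorem sq_sqrt_natCast (N : ℕ) : √(N : ℝ) ^ 2 = N := Real.sq_sqrt (Nat.cast_nonneg N)

theorem qEmb_mul_qConj {N : ℕ} (α : ℤ√(N : ℤ)) :
    qEmb α * qConj α = ((α.re ^ 2 - N * α.im ^ 2 : ℤ) : ℝ) := by
  unfold qEmb qConj
  push_cast
  linear_combination (-(α.im : ℝ) ^ 2) * sq_sqrt_natCast N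

theorem sq_sub_mul_sq_ne_zero {N : ℕ} (hN : ¬ IsSquare N) {x y : ℤ} (h : x ≠ 0 ∨ y ≠ 0) :
    x ^ 2 - N * y ^ 2 ≠ 0 := by
  have hd : ∀ n : ℤ, (N : ℤ) ≠ n * n := by
    intro n hn
    exact hN ⟨n.natAbs, by zify; rw [hn, ← abs_mul, abs_mul_self]⟩
  intro h0
  have := (Zsqrtd.norm_eq_zero hd (⟨x, y⟩ : ℤ√(N : ℤ))).mp (by
    simp only [Zsqrtd.norm]; linarith)
  have hx := congrArg Zsqrtd.re this
  have hy := congrArg Zsqrtd.im this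
  simp at hx hy
  tauto

theorem re_or_im_ne_zero {N : ℕ} {α : ℤ√(N : ℤ)} (h : α ≠ 0) : α.re ≠ 0 ∨ α.im ≠ 0 := by
  by_contra! h'
  exact h (Zsqrtd.ext h'.1 h'.2)

theorem qEmb_mul_qConj_ne_zero {N : ℕ} (hN : ¬ IsSquare N) {α : ℤ√(N : ℤ)} (h : α ≠ 0) :
    qEmb α * qConj α ≠ 0 := by
  rw [qEmb_mul_qConj]
  exact_mod_cast sq_sub_mul_sq_ne_zero hN (re_or_im_ne_zero h)

theorem qEmb_ne_zero {N : ℕ} (hN : ¬ IsSquare N) {α : ℤ√(N : ℤ)} (h : α ≠ 0) : qEmb α ≠ 0 :=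
  left_ne_zero_of_mul (qEmb_mul_qConj_ne_zero hN h)

theorem qConj_ne_zero {N : ℕ} (hN : ¬ IsSquare N) {α : ℤ√(N : ℤ)} (h : α ≠ 0) : qConj α ≠ 0 :=
  right_ne_zero_of_mul (qEmb_mul_qConj_ne_zero hN h)

@[simp] theorem qEmb_neg {N : ℕ} (α : ℤ√(N : ℤ)) : qEmb (-α) = -qEmb α := by
  simp [qEmb]; ring

@[simp] theorem qConj_neg {N : ℕ} (α : ℤ√(N : ℤ)) : qConj (-α) = -qConj α := by
  simp [qConj]; ring

@[simp] theorem logRatio_neg {N : ℕ} (α : ℤ√(N : ℤ)) : logRatio (-α) = logRatio α := by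
  simp [logRatio]

@[simp] theorem logRatio_one {N : ℕ} : logRatio (1 : ℤ√(N : ℤ)) = 0 := by
  simp [logRatio, qEmb, qConj]

theorem qEmb_sub {N : ℕ} (α β : ℤ√(N : ℤ)) : qEmb (α - β) = qEmb α - qEmb β := by
  simp [qEmb]; ring

theorem qEmb_add {N : ℕ} (α β : ℤ√(N : ℤ)) : qEmb (α + β) = qEmb α + qEmb β := by
  simp [qEmb]; ring

theorem qConj_sub {N : ℕ} (α β : ℤ√(N : ℤ)) : qConj (α - β) = qConj α - qConj β := by
  simp [qConj]; ring

theorem qConj_add {N : ℕ} (α β : ℤ√(N : ℤ)) : qConj (α + β) = qConj α + qConj β := by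
  simp [qConj]; ring

theorem eq_or_eq_neg_of_abs_qEmb_eq {N : ℕ} (hN : ¬ IsSquare N) {α β : ℤ√(N : ℤ)}
    (h : |qEmb α| = |qEmb β|) : α = β ∨ α = -β := by
  rcases abs_eq_abs.mp h with h | h
  · left
    by_contra hne
    exact qEmb_ne_zero hN (sub_ne_zero.mpr hne) (by rw [qEmb_sub, h, sub_self])
  · right
    by_contra hne
    refine qEmb_ne_zero hN (α := α + β) (fun h0 => hne (eq_neg_of_add_eq_zero_left h0)) ?_
    rw [qEmb_add, h, neg_add_cancel]

theorem logRatio_eq {N : ℕ} (hN : ¬ IsSquare N) {α : ℤ√(N : ℤ)} (h : α ≠ 0) :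
    logRatio α = 1 / 2 * (Real.log |qEmb α| - Real.log |qConj α|) := by
  rw [logRatio, abs_div, Real.log_div (abs_ne_zero.mpr (qEmb_ne_zero hN h))
    (abs_ne_zero.mpr (qConj_ne_zero hN h))]

theorem logRatio_lt_of_abs {N : ℕ} (hN : ¬ IsSquare N) {α β : ℤ√(N : ℤ)} (hα : α ≠ 0)
    (hβ : β ≠ 0) (h1 : |qEmb α| ≤ |qEmb β|) (h2 : |qConj β| < |qConj α|) :
    logRatio α < logRatio β := by
  rw [logRatio_eq hN hα, logRatio_eq hN hβ]
  have := Real.log_le_log (abs_pos.mpr (qEmb_ne_zero hN hα)) h1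
  have := Real.log_lt_log (abs_pos.mpr (qConj_ne_zero hN hβ)) h2
  linarith

theorem logRatio_le_of_abs {N : ℕ} (hN : ¬ IsSquare N) {α β : ℤ√(N : ℤ)} (hα : α ≠ 0)
    (hβ : β ≠ 0) (h1 : |qEmb α| ≤ |qEmb β|) (h2 : |qConj β| ≤ |qConj α|) :
    logRatio α ≤ logRatio β := by
  rw [logRatio_eq hN hα, logRatio_eq hN hβ]
  have := Real.log_le_log (abs_pos.mpr (qEmb_ne_zero hN hα)) h1
  have := Real.log_le_log (abs_pos.mpr (qConj_ne_zero hN hβ)) h2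
  linarith

/-! ### Forms as norm forms of bases. -/

/-- `(α, β)` is a positively oriented basis of `ℤ√N` in which the norm is the form `F`. -/
structure IsNormBasis {N : ℕ} (F : BinForm) (α β : ℤ√(N : ℤ)) : Prop where
  det : α.re * β.im - α.im * β.re = 1
  a_eq : F.a = α.re ^ 2 - N * α.im ^ 2
  b_eq : F.b = 2 * (α.re * β.re - N * α.im * β.im)
  c_eq : F.c = β.re ^ 2 - N * β.im ^ 2

namespace IsNormBasis

open BinForm

variable {N : ℕ} {F : BinForm} {α β : ℤ√(N : ℤ)}

theorem disc_eq (h : IsNormBasis F α β) : F.disc = 4 * N := by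
  rw [disc, h.a_eq, h.b_eq, h.c_eq]
  linear_combination 4 * N * (α.re * β.im - α.im * β.re + 1) * h.det

theorem sqrt_disc (h : IsNormBasis F α β) : √(F.disc : ℝ) = 2 * √(N : ℝ) := by
  rw [h.disc_eq, Real.sqrt_eq_iff_eq_sq (by positivity) (by positivity)]
  push_cast
  linear_combination -4 * sq_sqrt_natCast N

theorem left_ne_zero (h : IsNormBasis F α β) : α ≠ 0 := by
  rintro rfl
  simpa using h.det

theorem right_ne_zero (h : IsNormBasis F α β) : β ≠ 0 := by
  rintro rfl
  simpa using h.det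

theorem a_cast (h : IsNormBasis F α β) : (F.a : ℝ) = qEmb α * qConj α := by
  rw [qEmb_mul_qConj, h.a_eq]

theorem a_ne_zero (h : IsNormBasis F α β) (hN : ¬ IsSquare N) : F.a ≠ 0 := by
  rw [h.a_eq]; exact sq_sub_mul_sq_ne_zero hN (re_or_im_ne_zero h.left_ne_zero)

theorem c_ne_zero (h : IsNormBasis F α β) (hN : ¬ IsSquare N) : F.c ≠ 0 := by
  rw [h.c_eq]; exact sq_sub_mul_sq_ne_zero hN (re_or_im_ne_zero h.right_ne_zero)

theorem det_cast (h : IsNormBasis F α β) :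
    (α.re : ℝ) * β.im - α.im * β.re = 1 := by exact_mod_cast h.det

theorem b_cast (h : IsNormBasis F α β) :
    (F.b : ℝ) = 2 * (α.re * β.re - N * α.im * β.im) := by rw [h.b_eq]; push_cast; ring

/-- The irrational part of `ᾱβ` is the determinant of the basis, which is 1. Dividing by the norm of
`α` gives `β/α = (b + 2√N)/(2a)`, and the conjugate identity follows in the same way. -/
theorem two_mul_qConj_mul_qEmb (h : IsNormBasis F α β) :
    2 * (qConj α * qEmb β) = F.b + 2 * √(N : ℝ) := by
  rw [h.b_cast, qConj, qEmb]
  linear_combination 2 * √(N : ℝ) * h.det_cast - 2 * α.im * β.im * sq_sqrt_natCast N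

theorem two_mul_qEmb_mul_qConj (h : IsNormBasis F α β) :
    2 * (qEmb α * qConj β) = F.b - 2 * √(N : ℝ) := by
  rw [h.b_cast, qConj, qEmb]
  linear_combination -2 * √(N : ℝ) * h.det_cast - 2 * α.im * β.im * sq_sqrt_natCast N

theorem abs_a_mul_abs_qEmb (h : IsNormBasis F α β) :
    2 * |(F.a : ℝ)| * |qEmb β| = |F.b + 2 * √(N : ℝ)| * |qEmb α| := by
  rw [← h.two_mul_qConj_mul_qEmb, h.a_cast]
  simp only [abs_mul, abs_two]; ring

theorem abs_a_mul_abs_qConj (h : IsNormBasis F α β) :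
    2 * |(F.a : ℝ)| * |qConj β| = |F.b - 2 * √(N : ℝ)| * |qConj α| := by
  rw [← h.two_mul_qEmb_mul_qConj, h.a_cast]
  simp only [abs_mul, abs_two]; ring

/-- The quotient `(b + √Δ)/(b - √Δ)` is `ᾱβ/(αβ̄)`. This is what makes the distance telescope along
`ρ`. -/
theorem stepDist_eq (h : IsNormBasis F α β) (hN : ¬ IsSquare N) :
    F.stepDist = logRatio β - logRatio α := by
  have h1 := qEmb_ne_zero hN h.left_ne_zero
  have h2 := qConj_ne_zero hN h.left_ne_zero
  have h3 := qEmb_ne_zero hN h.right_ne_zero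
  have h4 := qConj_ne_zero hN h.right_ne_zero
  rw [stepDist, h.sqrt_disc, ← h.two_mul_qConj_mul_qEmb, ← h.two_mul_qEmb_mul_qConj, logRatio,
    logRatio, ← mul_sub, ← Real.log_div (by positivity) (by positivity), ← abs_div]
  congr 3
  field_simp

theorem not_isSquare_disc (h : IsNormBasis F α β) (hN : ¬ IsSquare N) : ¬ IsSquare F.disc := by
  rintro ⟨m, hm⟩
  rw [h.disc_eq] at hm
  have h2 : Even m := by
    have : Even (m * m) := hm ▸ ⟨2 * N, by ring⟩
    rcases Int.even_mul.mp this with h | h <;> exact h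
  obtain ⟨k, rfl⟩ := h2
  refine hN ⟨k.natAbs, ?_⟩
  zify
  rw [← abs_mul, abs_mul_self]
  linarith

theorem disc_pos (h : IsNormBasis F α β) (hN : ¬ IsSquare N) : 0 < F.disc := by
  rw [h.disc_eq]
  have : N ≠ 0 := by rintro rfl; exact hN ⟨0, rfl⟩
  positivity

theorem four_mul_c (h : IsNormBasis F α β) : 4 * F.a * F.c = F.b ^ 2 - 4 * N := by
  have := h.disc_eq
  rw [disc] at this
  linarith

theorem eq_of_b_eq {F' : BinForm} {α' β' : ℤ√(N : ℤ)} (h : IsNormBasis F α β)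
    (h' : IsNormBasis F' α' β') (hN : ¬ IsSquare N) (ha : F.a = F'.a) (hb : F.b = F'.b) :
    F = F' := by
  refine BinForm.ext ha hb ?_
  have h1 := h.four_mul_c
  have h2 := h'.four_mul_c
  rw [← hb, ← ha, ← h1] at h2
  exact (mul_left_cancel₀ (mul_ne_zero four_ne_zero (h.a_ne_zero hN)) h2).symm

/-- The reduction operator changes the basis `(α, β)` to `(β, kβ - α)`. -/
theorem rho (h : IsNormBasis F α β) (hN : ¬ IsSquare N) :
    ∃ k : ℤ, (BinForm.rho F).b = -F.b + 2 * F.c * k ∧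
      IsNormBasis (BinForm.rho F) β (⟨k * β.re - α.re, k * β.im - α.im⟩) := by
  have hc := h.c_ne_zero hN
  obtain ⟨k, hk⟩ :=
    (redResidue_spec F.disc F.b F.c hc (h.disc_pos hN) (h.not_isSquare_disc hN)).1
  have hb : redResidue F.disc F.b F.c = -F.b + 2 * F.c * k := by linarith
  refine ⟨k, hb, ⟨?_, h.c_eq, ?_, ?_⟩⟩
  · simp only; linear_combination h.det
  · simp only [BinForm.rho]; rw [hb, h.b_eq, h.c_eq]; ring
  · simp only [BinForm.rho]
    have : redResidue F.disc F.b F.c ^ 2 - F.disc = 4 * F.c * (F.a - k * F.b + k ^ 2 * F.c) := by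
      rw [hb, disc]; ring
    rw [this, Int.mul_ediv_cancel_left _ (mul_ne_zero four_ne_zero hc), h.a_eq, h.b_eq, h.c_eq]
    ring

end IsNormBasis

/-! ### Normalized forms and termination of reduction. -/

namespace BinForm

/-- The range of the middle coefficient after an application of the reduction operator to a form
of discriminant `4 * N`. -/
def IsNormalized (N : ℕ) (F : BinForm) : Prop :=
  (2 * √(N : ℝ) < |(F.a : ℝ)| → |(F.b : ℝ)| ≤ |(F.a : ℝ)|) ∧
    (|(F.a : ℝ)| < 2 * √(N : ℝ) →
      2 * √(N : ℝ) - 2 * |(F.a : ℝ)| < F.b ∧ (F.b : ℝ) < 2 * √(N : ℝ))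

end BinForm

namespace IsNormBasis

open BinForm

variable {N : ℕ} {F : BinForm} {α β : ℤ√(N : ℤ)}

theorem isNormalized_rho (h : IsNormBasis F α β) (hN : ¬ IsSquare N) :
    IsNormalized N (BinForm.rho F) := by
  have hs := redResidue_spec F.disc F.b F.c (h.c_ne_zero hN) (h.disc_pos hN)
    (h.not_isSquare_disc hN)
  rw [IsRedResidue, h.sqrt_disc] at hs
  refine ⟨fun h1 => ?_, hs.2.2⟩
  have h2 := hs.2.1 h1
  simp only [BinForm.rho]
  have : |redResidue F.disc F.b F.c| ≤ |F.c| := abs_le.mpr ⟨h2.1.le, h2.2⟩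
  exact_mod_cast this

theorem abs_ne_sqrt {N : ℕ} (hN : ¬ IsSquare N) (a : ℤ) : |(a : ℝ)| ≠ √(N : ℝ) := by
  intro h
  have h1 := sq_sqrt_natCast N
  rw [← h, sq_abs] at h1
  refine hN ⟨a.natAbs, ?_⟩
  zify
  rw [← abs_mul, abs_mul_self, ← sq]
  exact_mod_cast h1.symm

theorem abs_a_ne (h : IsNormBasis F α β) (hN : ¬ IsSquare N) (a : ℤ) :
    |(a : ℝ)| ≠ 2 * √(N : ℝ) := by
  rw [← h.sqrt_disc, h.disc_eq]
  have h1 : ¬ IsSquare (4 * N) := by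
    intro h2
    apply h.not_isSquare_disc hN
    rw [h.disc_eq]
    obtain ⟨m, hm⟩ := h2
    exact ⟨m, by exact_mod_cast hm⟩
  exact_mod_cast abs_ne_sqrt h1 a

theorem isReduced_iff (h : IsNormBasis F α β) :
    F.IsReduced ↔ |2 * √(N : ℝ) - 2 * abs (F.a : ℝ)| < F.b ∧ (F.b : ℝ) < 2 * √(N : ℝ) := by
  rw [BinForm.IsReduced, h.sqrt_disc]

/-- Normalization forces `|b - 2√N| ≤ 2|a|`, and `|β̄/ᾱ|` is the quotient of these two. So along
normalized forms the conjugates of the left basis elements never grow. -/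
theorem abs_qConj_le_of_isNormalized (h : IsNormBasis F α β) (hN : ¬ IsSquare N)
    (hn : IsNormalized N F) : |qConj β| ≤ |qConj α| := by
  have ha : 0 < |(F.a : ℝ)| := abs_pos.mpr (by exact_mod_cast h.a_ne_zero hN)
  have h1 : |F.b - 2 * √(N : ℝ)| ≤ 2 * |(F.a : ℝ)| := by
    rcases lt_or_gt_of_ne (h.abs_a_ne hN F.a) with h2 | h2
    · have := hn.2 h2
      rw [abs_le]; constructor <;> linarith
    · have := abs_le.mp (hn.1 h2)
      have := Real.sqrt_nonneg (N : ℝ)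
      rw [abs_le]; constructor <;> linarith
  have h2 := h.abs_a_mul_abs_qConj
  have h3 := mul_le_mul_of_nonneg_right h1 (abs_nonneg (qConj α))
  rw [← h2] at h3
  exact le_of_mul_le_mul_left h3 (by positivity)

theorem iterate_rho (h : IsNormBasis F α β) (hN : ¬ IsSquare N) (n : ℕ) :
    ∃ α' β' : ℤ√(N : ℤ), IsNormBasis (BinForm.rho^[n] F) α' β' ∧
      F.infraDist n = logRatio α' - logRatio α ∧
      (IsNormalized N F → |qConj α'| ≤ |qConj α| ∧ IsNormalized N (BinForm.rho^[n] F)) := by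
  induction n with
  | zero => exact ⟨α, β, h, by simp [infraDist], fun hn => ⟨le_rfl, hn⟩⟩
  | succ n ih =>
    obtain ⟨α', β', h', hd, hn⟩ := ih
    obtain ⟨k, -, hk⟩ := h'.rho hN
    rw [Function.iterate_succ_apply']
    refine ⟨_, _, hk, ?_, fun hF => ⟨?_, h'.isNormalized_rho hN⟩⟩
    · rw [infraDist, Finset.sum_range_succ, ← infraDist, hd, h'.stepDist_eq hN]; ring
    · exact (h'.abs_qConj_le_of_isNormalized hN (hn hF).2).trans (hn hF).1

theorem isReduced_of_isNormalized (h : IsNormBasis F α β) (hn : IsNormalized N F)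
    (ha : |(F.a : ℝ)| < √(N : ℝ)) : F.IsReduced := by
  have h1 := hn.2 (by linarith [abs_nonneg (F.a : ℝ)])
  rw [h.isReduced_iff, abs_of_nonneg (by linarith)]
  exact h1

theorem four_mul_abs_c (h : IsNormBasis F α β) :
    4 * |(F.a : ℝ)| * |(F.c : ℝ)| = |(F.b : ℝ) ^ 2 - 4 * N| := by
  have : 4 * (F.a : ℝ) * F.c = (F.b : ℝ) ^ 2 - 4 * N := by exact_mod_cast h.four_mul_c
  rw [← this]
  simp [abs_mul]

theorem abs_c_lt_of_isNormalized (h : IsNormBasis F α β) (hN : ¬ IsSquare N)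
    (hn : IsNormalized N F) (ha : √(N : ℝ) < |(F.a : ℝ)|) : |(F.c : ℝ)| < |(F.a : ℝ)| := by
  have hw := sq_sqrt_natCast N
  have hw0 := Real.sqrt_nonneg (N : ℝ)
  have h4 := h.four_mul_abs_c
  have key : |(F.b : ℝ) ^ 2 - 4 * N| < 4 * |(F.a : ℝ)| * |(F.a : ℝ)| := by
    rw [← hw, abs_lt]
    rcases lt_or_gt_of_ne (h.abs_a_ne hN F.a) with h2 | h2
    · obtain ⟨h5, h6⟩ := hn.2 h2
      constructor <;> nlinarith [sq_nonneg (F.b : ℝ)]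
    · have h5 := hn.1 h2
      have h6 := sq_abs (F.b : ℝ)
      constructor <;> nlinarith [sq_nonneg (F.b : ℝ), abs_nonneg (F.b : ℝ)]
  rw [← h4] at key
  exact lt_of_mul_lt_mul_left key (by positivity)

/-- Descent on `|a|`: below `√N` a normalized form is reduced; above it `|c| < |a|`, and `ρ` moves
`c` into first place. -/
theorem exists_isReduced_of_isNormalized (h : IsNormBasis F α β) (hN : ¬ IsSquare N)
    (hn : IsNormalized N F) : ∃ n, (BinForm.rho^[n] F).IsReduced := by
  induction hm : F.a.natAbs using Nat.strong_induction_on generalizing F α β with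
  | _ m ih =>
    rcases lt_or_gt_of_ne (abs_ne_sqrt hN F.a) with ha | ha
    · exact ⟨0, h.isReduced_of_isNormalized hn ha⟩
    · have hlt := h.abs_c_lt_of_isNormalized hN hn ha
      obtain ⟨k, -, hk⟩ := h.rho hN
      have hlt' : F.c.natAbs < F.a.natAbs := by
        have : |F.c| < |F.a| := by exact_mod_cast hlt
        zify; exact this
      obtain ⟨n, hr⟩ := ih F.c.natAbs (hm ▸ hlt') hk (h.isNormalized_rho hN) rfl
      exact ⟨n + 1, hr⟩

/-- One application of `ρ` normalizes any form, so the infimum in `redCount` is attained and is not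
the default value of an empty set. -/
theorem isReduced_iterate_redCount (h : IsNormBasis F α β) (hN : ¬ IsSquare N) :
    (BinForm.rho^[F.redCount] F).IsReduced := by
  obtain ⟨k, -, hk⟩ := h.rho hN
  obtain ⟨n, hr⟩ := hk.exists_isReduced_of_isNormalized hN (h.isNormalized_rho hN)
  exact Nat.sInf_mem (s := {r | (BinForm.rho^[r] F).IsReduced}) ⟨n + 1, hr⟩

theorem isReduced_bounds (h : IsNormBasis F α β) (hr : F.IsReduced) :
    |(F.a : ℝ)| < 2 * √(N : ℝ) ∧ 0 < (F.b : ℝ) ∧ (F.b : ℝ) < 2 * √(N : ℝ) ∧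
      2 * |(F.a : ℝ)| < F.b + 2 * √(N : ℝ) ∧ 2 * √(N : ℝ) - F.b < 2 * |(F.a : ℝ)| := by
  obtain ⟨h1, h2⟩ := h.isReduced_iff.mp hr
  have h3 := abs_lt.mp h1
  have h4 := (abs_nonneg _).trans_lt h1
  refine ⟨?_, h4, h2, ?_, ?_⟩ <;> linarith

end IsNormBasis

/-! ### How far reduction can move back. -/

namespace IsNormBasis

open BinForm

variable {N : ℕ} {F : BinForm} {α β : ℤ√(N : ℤ)}

theorem _root_.BinForm.infraDist_succ' (F : BinForm) (n : ℕ) :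
    F.infraDist (n + 1) = F.stepDist + (BinForm.rho F).infraDist n := by
  rw [infraDist, Finset.sum_range_succ', infraDist]
  simp [add_comm]

/-- If `|b|` exceeds the first bound, then `4|a||c| = (|b| - 2√N)(|b| + 2√N)` yields `|c| > |b| +
2√N`. The dichotomy controls the first reduction step, where the form need not be normalized. -/
theorem abs_b_le_or (h : IsNormBasis F α β) (hN : ¬ IsSquare N) :
    |(F.b : ℝ)| ≤ 4 * |(F.a : ℝ)| + 2 * √(N : ℝ) ∨
      2 * √(N : ℝ) < |(F.c : ℝ)| ∧ |(F.b : ℝ)| < |(F.c : ℝ)| := by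
  have hw := sq_sqrt_natCast N
  have hw0 := Real.sqrt_nonneg (N : ℝ)
  have ha : 0 < |(F.a : ℝ)| := abs_pos.mpr (by exact_mod_cast h.a_ne_zero hN)
  by_contra! hcon
  obtain ⟨h1, h2⟩ := hcon
  have h4 := h.four_mul_abs_c
  have h5 : 4 * |(F.a : ℝ)| * (|(F.b : ℝ)| + 2 * √(N : ℝ)) < 4 * |(F.a : ℝ)| * |(F.c : ℝ)| := by
    rw [h4]
    refine lt_of_lt_of_le ?_ (le_abs_self _)
    rw [← sq_abs (F.b : ℝ), show |(F.b : ℝ)| ^ 2 - 4 * N =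
      (|(F.b : ℝ)| - 2 * √(N : ℝ)) * (|(F.b : ℝ)| + 2 * √(N : ℝ)) by linear_combination 4 * hw]
    have h6 : 4 * |(F.a : ℝ)| < |(F.b : ℝ)| - 2 * √(N : ℝ) := by linarith
    have h7 : 0 < |(F.b : ℝ)| + 2 * √(N : ℝ) := by linarith
    exact mul_lt_mul_of_pos_right h6 h7
  have h6 := lt_of_mul_lt_mul_left h5 (by positivity)
  rcases lt_or_gt_of_ne (h.abs_a_ne hN F.c) with hc | hc
  · linarith [abs_nonneg (F.b : ℝ)]
  · linarith [h2 hc]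

theorem exists_iterate_rho_of_isReduced (h : IsNormBasis F α β) (hN : ¬ IsSquare N) {n : ℕ}
    (hr : (BinForm.rho^[n] F).IsReduced) :
    ∃ α' β' : ℤ√(N : ℤ), IsNormBasis (BinForm.rho^[n] F) α' β' ∧
      F.infraDist n = logRatio α' - logRatio α ∧
      |(F.a : ℝ)| * |qConj α'| ≤ (2 * |(F.a : ℝ)| + 2 * √(N : ℝ)) * |qConj α| := by
  have hw0 := Real.sqrt_nonneg (N : ℝ)
  have ha : 0 < |(F.a : ℝ)| := abs_pos.mpr (by exact_mod_cast h.a_ne_zero hN)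
  have hα := abs_nonneg (qConj α)
  have htriv : |(F.a : ℝ)| * |qConj α| ≤ (2 * |(F.a : ℝ)| + 2 * √(N : ℝ)) * |qConj α| :=
    mul_le_mul_of_nonneg_right (by linarith) hα
  cases n with
  | zero => exact ⟨α, β, h, by simp [infraDist], htriv⟩
  | succ n =>
    obtain ⟨k, hb, hk⟩ := h.rho hN
    have hn := h.isNormalized_rho hN
    -- For moderate `b` the first step enlarges the conjugate by a bounded factor, and later steps
    -- do not enlarge it. For large `c` the first step only swaps the basis to `(β, -α)`, and the
    -- second brings `α` back up to sign, now as the left element for a normalized form.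
    rcases h.abs_b_le_or hN with hle | ⟨h1, h2⟩
    · obtain ⟨α', β', h', hd, hl⟩ := hk.iterate_rho hN n
      refine ⟨α', β', h', ?_, ?_⟩
      · rw [infraDist_succ', hd, h.stepDist_eq hN]; ring
      · have h3 := h.abs_a_mul_abs_qConj
        have h4 : |F.b - 2 * √(N : ℝ)| ≤ 4 * |(F.a : ℝ)| + 4 * √(N : ℝ) := by
          refine (abs_sub _ _).trans ?_
          rw [abs_of_nonneg (by positivity : 0 ≤ 2 * √(N : ℝ))]
          linarith
        have h5 := mul_le_mul_of_nonneg_right h4 hα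
        have h6 := mul_le_mul_of_nonneg_left (hl hn).1 ha.le
        linarith
    · cases n with
      | zero =>
        have := (hk.isReduced_bounds hr).1
        simp only [BinForm.rho] at this
        linarith
      | succ n =>
        -- Both `-b` and the residue `-b + 2ck` have absolute value at most `|c|`, the former
        -- strictly, so they coincide.
        have hk0 : k = 0 := by
          have h3 := hn.1 h1
          rw [hb] at h3
          simp only [BinForm.rho] at h3
          have h4 : |-F.b + 2 * F.c * k| ≤ |F.c| := by exact_mod_cast h3
          have h5 : |F.b| < |F.c| := by exact_mod_cast h2
          by_contra hne
          have h6 : |2 * F.c * k| ≤ |-F.b + 2 * F.c * k| + |F.b| := by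
            calc |2 * F.c * k| = |(-F.b + 2 * F.c * k) + F.b| := by ring_nf
              _ ≤ _ := abs_add_le _ _
          rw [abs_mul, abs_mul, abs_two] at h6
          have h7 := Int.one_le_abs hne
          nlinarith [abs_nonneg F.c]
        have hk' : IsNormBasis (BinForm.rho F) β (-α) := by
          convert hk using 1
          rw [hk0]
          ext <;> simp
        obtain ⟨j, -, hj⟩ := hk'.rho hN
        obtain ⟨α', β', h', hd, hl⟩ := hj.iterate_rho hN n
        refine ⟨α', β', h', ?_, ?_⟩
        · rw [infraDist_succ', infraDist_succ', hd, h.stepDist_eq hN, hk'.stepDist_eq hN]; ring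
        · have := (hl (hk'.isNormalized_rho hN)).1
          rw [qConj_neg, abs_neg] at this
          exact (mul_le_mul_of_nonneg_left this ha.le).trans htriv

theorem log_abs_qEmb (h : IsNormBasis F α β) (hN : ¬ IsSquare N) :
    Real.log |qEmb α| = Real.log |(F.a : ℝ)| - Real.log |qConj α| := by
  rw [h.a_cast, abs_mul, Real.log_mul (abs_ne_zero.mpr (qEmb_ne_zero hN h.left_ne_zero))
    (abs_ne_zero.mpr (qConj_ne_zero hN h.left_ne_zero))]
  ring

/-- The reduction of a form cannot move back by more than a logarithm of its size. -/
theorem neg_log_le_infraDist (h : IsNormBasis F α β) (hN : ¬ IsSquare N) {n : ℕ}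
    (hr : (BinForm.rho^[n] F).IsReduced) :
    -Real.log (2 * |(F.a : ℝ)| + 2 * √(N : ℝ)) ≤ F.infraDist n := by
  obtain ⟨α', β', h', hd, hle⟩ := h.exists_iterate_rho_of_isReduced hN hr
  have ha : 1 ≤ |(F.a : ℝ)| := by exact_mod_cast Int.one_le_abs (h.a_ne_zero hN)
  have ha' : 1 ≤ |((BinForm.rho^[n] F).a : ℝ)| := by
    exact_mod_cast Int.one_le_abs (h'.a_ne_zero hN)
  have hα := abs_pos.mpr (qConj_ne_zero hN h.left_ne_zero)
  have hα' := abs_pos.mpr (qConj_ne_zero hN h'.left_ne_zero)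
  have hw0 := Real.sqrt_nonneg (N : ℝ)
  have h1 := Real.log_le_log (by positivity) hle
  rw [Real.log_mul (by positivity) (by positivity),
    Real.log_mul (by positivity) (by positivity)] at h1
  have h2 := Real.log_nonneg ha
  have h3 := Real.log_nonneg ha'
  rw [hd, logRatio_eq hN h.left_ne_zero, logRatio_eq hN h'.left_ne_zero, h.log_abs_qEmb hN,
    h'.log_abs_qEmb hN]
  linarith

/-- The form represents 1, namely at the coordinates of `1 ∈ ℤ√N` in the basis, so it is primitive.
-/
theorem eq_one_of_dvd (h : IsNormBasis F α β) {d : ℕ} (ha : (d : ℤ) ∣ F.a) (hb : (d : ℤ) ∣ F.b)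
    (hc : (d : ℤ) ∣ F.c) : d = 1 := by
  have h1 : F.a * β.im ^ 2 - F.b * (β.im * α.im) + F.c * α.im ^ 2 = 1 := by
    rw [h.a_eq, h.b_eq, h.c_eq]
    linear_combination (α.re * β.im - α.im * β.re + 1) * h.det
  have h2 : (d : ℤ) ∣ 1 := by
    rw [← h1]
    exact dvd_add (dvd_sub (ha.mul_right _) (hb.mul_right _)) (hc.mul_right _)
  exact Nat.dvd_one.mp (by exact_mod_cast h2)

/-! ### Squaring under Gauss composition. -/

/-- The composition of a form with itself, up to a rational factor, squares the basis. -/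
theorem gaussComp_self (h : IsNormBasis F α β) (hN : ¬ IsSquare N) {w : ℤ × ℤ × ℤ}
    (hw : F.a * w.1 + F.a * w.2.1 + beta F F * w.2.2 =
      (Int.gcd F.a (Int.gcd F.a (beta F F)) : ℤ)) :
    ∃ α' β' : ℤ√(N : ℤ), IsNormBasis (gaussComp F F w) α' β' ∧
      logRatio α' = 2 * logRatio α ∧ |(gaussComp F F w).a| ≤ F.a ^ 2 := by
  have hβ : beta F F = F.b := by
    rw [beta, ← two_mul, Int.mul_ediv_cancel_left _ two_ne_zero]
  rw [hβ] at hw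
  obtain ⟨s, u, v⟩ := w
  simp only at hw
  have hgc : gaussComp F F (s, u, v) =
      let n : ℤ := Int.gcd F.a (Int.gcd F.a F.b)
      let d₀ : ℤ := Int.gcd n (Int.gcd F.c (Int.gcd F.c ((F.b - F.b) / 2)))
      let a₃ : ℤ := d₀ * F.a * F.a / n ^ 2
      let b₃ : ℤ := F.b + 2 * F.a / n * (s * ((F.b - F.b) / 2) - F.c * v)
      ⟨a₃, b₃, (b₃ ^ 2 - F.disc) / (4 * a₃)⟩ := by
    rw [gaussComp, hβ]
  set n : ℕ := Int.gcd F.a (Int.gcd F.a F.b) with hn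
  have hna : (n : ℤ) ∣ F.a := Int.gcd_dvd_left ..
  have hnb : (n : ℤ) ∣ F.b := (Int.gcd_dvd_right ..).trans (Int.gcd_dvd_right ..)
  have hn0 : (n : ℤ) ≠ 0 := fun h0 => h.a_ne_zero hN (zero_dvd_iff.mp (h0 ▸ hna))
  have hd : Int.gcd n (Int.gcd F.c (Int.gcd F.c ((F.b - F.b) / 2))) = 1 := by
    refine h.eq_one_of_dvd ((Int.gcd_dvd_left ..).trans hna) ((Int.gcd_dvd_left ..).trans hnb) ?_
    exact (Int.gcd_dvd_right ..).trans (Int.gcd_dvd_left ..)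
  obtain ⟨a₁, ha₁⟩ := hna
  obtain ⟨b₁, hb₁⟩ := hnb
  simp only [hd] at hgc
  have e1 : ((1 : ℕ) : ℤ) * F.a * F.a / (n : ℤ) ^ 2 = a₁ ^ 2 := by
    rw [ha₁, show ((1 : ℕ) : ℤ) * (n * a₁) * (n * a₁) = (n : ℤ) ^ 2 * a₁ ^ 2 by push_cast; ring,
      Int.mul_ediv_cancel_left _ (pow_ne_zero 2 hn0)]
  have e2 : 2 * F.a / (n : ℤ) = 2 * a₁ := by
    rw [ha₁, show 2 * ((n : ℤ) * a₁) = n * (2 * a₁) by ring, Int.mul_ediv_cancel_left _ hn0]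
  rw [e1, e2, sub_self, Int.zero_ediv, mul_zero, zero_sub] at hgc
  have ha₁0 : a₁ ≠ 0 := by
    rintro rfl
    exact h.a_ne_zero hN (by rw [ha₁, mul_zero])
  obtain ⟨p, q⟩ := α
  obtain ⟨r, t⟩ := β
  obtain ⟨hdet, ha, hb, hc⟩ := h
  simp only at hdet ha hb hc
  -- Here `p' + q'√N` is `α²/n`, written integrally through `tα - qβ = 1`, and `r' + t'√N` is `β(eα
  -- + vβ)`. The Bézout relation `n = ae + bv` gives the new basis determinant 1.
  set p' := (t * a₁ - q * b₁) * p + q * a₁ * r with hp'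
  set q' := (t * a₁ - q * b₁) * q + q * a₁ * t with hq'
  set e := s + u with he
  set r' := r * (e * p + v * r) + N * t * (e * q + v * t) with hr'
  set t' := r * (e * q + v * t) + t * (e * p + v * r) with ht'
  have hp : n * p' = p ^ 2 + N * q ^ 2 := by
    rw [hp']
    linear_combination (-(t * p + q * r)) * (ha₁.symm.trans ha).symm +
      q * p * (hb₁.symm.trans hb).symm +
      (p ^ 2 + N * q ^ 2) * hdet
  have hq : n * q' = 2 * p * q := by
    rw [hq']
    linear_combination (-(2 * t * q)) * (ha₁.symm.trans ha).symm +
      q ^ 2 * (hb₁.symm.trans hb).symm + 2 * p * q * hdet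
  have hnw : (n : ℤ) = (p ^ 2 - N * q ^ 2) * e + 2 * (p * r - N * q * t) * v := by
    rw [← hw, ha, hb]; ring
  have hdet' : p' * t' - q' * r' = 1 := by
    refine mul_left_cancel₀ hn0 ?_
    have : (n : ℤ) * (p' * t' - q' * r') = n * p' * t' - n * q' * r' := by ring
    rw [this, hp, hq, mul_one, hnw]
    linear_combination ((p ^ 2 - N * q ^ 2) * e + 2 * (p * r - N * q * t) * v) * hdet
  have hA : a₁ ^ 2 = p' ^ 2 - N * q' ^ 2 := by
    refine mul_left_cancel₀ (pow_ne_zero 2 hn0) ?_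
    have : (n : ℤ) ^ 2 * (p' ^ 2 - N * q' ^ 2) = (n * p') ^ 2 - N * (n * q') ^ 2 := by ring
    rw [this, hp, hq, ← mul_pow, ← ha₁, ha]
    ring
  have hB : F.b + 2 * a₁ * -(F.c * v) = 2 * (p' * r' - N * q' * t') := by
    refine mul_left_cancel₀ hn0 ?_
    have h1 : (n : ℤ) * (2 * (p' * r' - N * q' * t')) =
      2 * (n * p' * r' - N * (n * q') * t') := by ring
    have h2 : (n : ℤ) * (F.b + 2 * a₁ * -(F.c * v)) = n * F.b - 2 * (n * a₁) * F.c * v := by ring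
    rw [h1, h2, hp, hq, ← ha₁, ha, hb, hc, hnw]
    ring
  have hdisc : F.disc = 4 * N := by
    rw [disc, ha, hb, hc]
    linear_combination 4 * N * (p * t - q * r + 1) * hdet
  refine ⟨⟨p', q'⟩, ⟨r', t'⟩, ⟨hdet', ?_, ?_, ?_⟩, ?_, ?_⟩
  · rw [hgc]; exact hA
  · rw [hgc]; exact hB
  · rw [hgc]
    simp only
    have : (F.b + 2 * a₁ * -(F.c * v)) ^ 2 - F.disc = 4 * a₁ ^ 2 * (r' ^ 2 - N * t' ^ 2) := by
      rw [hB, hdisc, hA]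
      linear_combination 4 * N * (p' * t' - q' * r' + 1) * hdet'
    rw [this, Int.mul_ediv_cancel_left _ (mul_ne_zero four_ne_zero (pow_ne_zero 2 ha₁0))]
  · have hpR : (n : ℝ) * p' = p ^ 2 + N * q ^ 2 := by exact_mod_cast hp
    have hqR : (n : ℝ) * q' = 2 * p * q := by exact_mod_cast hq
    have hn0' : (n : ℝ) ≠ 0 := by exact_mod_cast hn0
    have h1 : n * qEmb (⟨p', q'⟩ : ℤ√(N : ℤ)) = qEmb (⟨p, q⟩ : ℤ√(N : ℤ)) ^ 2 := by
      simp only [qEmb]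
      linear_combination hpR + √(N : ℝ) * hqR - q ^ 2 * sq_sqrt_natCast N
    have h2 : n * qConj (⟨p', q'⟩ : ℤ√(N : ℤ)) = qConj (⟨p, q⟩ : ℤ√(N : ℤ)) ^ 2 := by
      simp only [qConj]
      linear_combination hpR - √(N : ℝ) * hqR - q ^ 2 * sq_sqrt_natCast N
    rw [logRatio, ← mul_div_mul_left (qEmb _) _ hn0', h1, h2, ← div_pow, abs_pow, Real.log_pow, logRatio]
    push_cast
    ring
  · rw [hgc, abs_of_nonneg (sq_nonneg _), ha₁]
    rw [mul_pow]
    exact le_mul_of_one_le_left (sq_nonneg _) ((one_le_sq_iff_one_le_abs _).mpr (Int.one_le_abs hn0))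

end IsNormBasis

/-! ### The continued fraction of `√N` and the principal cycle. -/

theorem cfPQ_succ_fst (N m : ℕ) :
    (cfPQ N (m + 1)).1 = cfA N m * (cfPQ N m).2 - (cfPQ N m).1 := rfl

theorem cfPQ_succ_snd (N m : ℕ) :
    (cfPQ N (m + 1)).2 = ((N : ℤ) - (cfPQ N (m + 1)).1 ^ 2) / (cfPQ N m).2 := rfl

/-- The next `P` of the continued fraction algorithm lies in the half-open window of length `Q`
below `√N`. -/
theorem cfPQ_succ_fst_mem {N m : ℕ} (hN : ¬ IsSquare N) (hQ : 0 < (cfPQ N m).2) :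
    √(N : ℝ) - (cfPQ N m).2 < (cfPQ N (m + 1)).1 ∧ ((cfPQ N (m + 1)).1 : ℝ) < √(N : ℝ) := by
  have hQ' : (0 : ℝ) < (cfPQ N m).2 := by exact_mod_cast hQ
  have h1 := Int.floor_le ((((cfPQ N m).1 : ℝ) + √(N : ℝ)) / ((cfPQ N m).2 : ℝ))
  have h2 := Int.lt_floor_add_one ((((cfPQ N m).1 : ℝ) + √(N : ℝ)) / ((cfPQ N m).2 : ℝ))
  rw [← cfA] at h1 h2
  rw [le_div_iff₀ hQ'] at h1
  rw [div_lt_iff₀ hQ'] at h2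
  have h3 : ((cfPQ N (m + 1)).1 : ℝ) = cfA N m * (cfPQ N m).2 - (cfPQ N m).1 := by
    rw [cfPQ_succ_fst]; push_cast; ring
  have h4 : ((cfPQ N (m + 1)).1 : ℝ) ≠ √(N : ℝ) := fun h => by
    refine IsNormBasis.abs_ne_sqrt hN (cfPQ N (m + 1)).1 ?_
    rw [h, abs_of_nonneg (Real.sqrt_nonneg _)]
  exact ⟨by linarith, lt_of_le_of_ne (by linarith) h4⟩

/-- The middle inequality encodes reducedness. The factorization `Q_m Q_{m+1} = (√N - P_{m+1})(√N +
P_{m+1})` carries the window `√N - P_{m+1} < Q < √N + P_{m+1}` from `Q_m` to `Q_{m+1}`, which keeps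
`Q` positive and the next partial quotient at least 1. -/
theorem cfPQ_invariant {N : ℕ} (hN : ¬ IsSquare N) (m : ℕ) :
    0 < (cfPQ N m).2 ∧ |√(N : ℝ) - (cfPQ N m).2| < (cfPQ N (m + 1)).1 ∧
      (cfPQ N m).2 * (cfPQ N (m + 1)).2 = N - (cfPQ N (m + 1)).1 ^ 2 := by
  have hw := sq_sqrt_natCast N
  induction m with
  | zero =>
    have hN1 : 1 ≤ N := Nat.pos_of_ne_zero (by rintro rfl; exact hN ⟨0, rfl⟩)
    have h1 : (1 : ℝ) ≤ √(N : ℝ) := Real.one_le_sqrt.mpr (by exact_mod_cast hN1)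
    have h2 := cfPQ_succ_fst_mem (m := 0) hN (by simp [cfPQ])
    refine ⟨by simp [cfPQ], ?_, ?_⟩
    · have h3 : ((cfPQ N 0).2 : ℝ) = 1 := by simp [cfPQ]
      rw [h3] at h2 ⊢
      rw [abs_of_nonneg (by linarith)]
      exact h2.1
    · rw [cfPQ_succ_snd]; simp [cfPQ]
  | succ m ih =>
    obtain ⟨hQ, h1, h2⟩ := ih
    have hP := (cfPQ_succ_fst_mem hN hQ).2
    have hQ' : (0 : ℝ) < (cfPQ N m).2 := by exact_mod_cast hQ
    set Q : ℝ := ((cfPQ N m).2 : ℝ)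
    set Q₁ : ℝ := ((cfPQ N (m + 1)).2 : ℝ) with hQ₁
    set P : ℝ := ((cfPQ N (m + 1)).1 : ℝ) with hPdef
    have h2' : Q * Q₁ = (√(N : ℝ) - P) * (√(N : ℝ) + P) := by
      have : Q * Q₁ = N - P ^ 2 := by simp only [Q, hQ₁, hPdef]; exact_mod_cast h2
      rw [this]; linear_combination -hw
    obtain ⟨h3, h4⟩ := abs_lt.mp h1
    have hP0 : 0 < P := (abs_nonneg _).trans_lt h1
    have h5 : Q₁ < √(N : ℝ) + P := by
      by_contra! h
      nlinarith
    have h6 : √(N : ℝ) - P < Q₁ := by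
      by_contra! h
      nlinarith
    have hpos : 0 < Q₁ := by linarith
    have hposZ : 0 < (cfPQ N (m + 1)).2 := by rw [hQ₁] at hpos; exact_mod_cast hpos
    obtain ⟨h7, h8⟩ := cfPQ_succ_fst_mem hN hposZ
    refine ⟨hposZ, ?_, ?_⟩
    · rw [abs_lt]
      refine ⟨?_, by linarith⟩
      have h9 : 1 ≤ cfA N (m + 1) := by
        rw [cfA, Int.le_floor, Int.cast_one, one_le_div hpos]
        linarith
      have h10 : (1 : ℝ) ≤ cfA N (m + 1) := by exact_mod_cast h9
      have h11 : ((cfPQ N (m + 1 + 1)).1 : ℝ) = cfA N (m + 1) * Q₁ - P := by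
        rw [cfPQ_succ_fst]; push_cast; rfl
      rw [h11]
      nlinarith
    · rw [cfPQ_succ_snd N (m + 1)]
      refine Int.mul_ediv_cancel' ?_
      refine ⟨(cfPQ N m).2 - cfA N (m + 1) ^ 2 * (cfPQ N (m + 1)).2 +
        2 * cfA N (m + 1) * (cfPQ N (m + 1)).1, ?_⟩
      rw [cfPQ_succ_fst N (m + 1)]
      linear_combination -h2

theorem disc_upsilon {N : ℕ} (hN : ¬ IsSquare N) (m : ℕ) : (upsilon N m).disc = 4 * N := by
  have h := (cfPQ_invariant hN m).2.2
  have h1 : ((-1 : ℤ) ^ m) ^ 2 = 1 := by rw [← pow_mul, mul_comm, pow_mul]; simp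
  simp only [upsilon, BinForm.disc, pow_succ]
  linear_combination 4 * h + 4 * (cfPQ N m).2 * (cfPQ N (m + 1)).2 * h1

theorem sqrt_four_mul (N : ℕ) : √(((4 * N : ℤ)) : ℝ) = 2 * √(N : ℝ) := by
  rw [Real.sqrt_eq_iff_eq_sq (by positivity) (by positivity)]
  push_cast
  linear_combination -4 * sq_sqrt_natCast N

theorem abs_neg_one_pow_mul_cast (m : ℕ) (x : ℤ) : |(((-1) ^ m * x : ℤ) : ℝ)| = |(x : ℝ)| := by
  push_cast
  simp [abs_mul]

theorem isReduced_upsilon {N : ℕ} (hN : ¬ IsSquare N) (m : ℕ) : (upsilon N m).IsReduced := by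
  obtain ⟨hQ, h1, -⟩ := cfPQ_invariant hN m
  have h2 := (cfPQ_succ_fst_mem hN hQ).2
  have hQ' : (0 : ℝ) < (cfPQ N m).2 := by exact_mod_cast hQ
  rw [BinForm.IsReduced, disc_upsilon hN, sqrt_four_mul]
  simp only [upsilon]
  rw [abs_neg_one_pow_mul_cast, abs_of_pos hQ']
  push_cast
  rw [abs_lt] at h1 ⊢
  refine ⟨⟨?_, ?_⟩, ?_⟩ <;> linarith

/-- By uniqueness of the residue: `2P_{m+2}` has the right congruence class and lies in the window
below `2√N`. The other branch of the residue is void, since `Q_{m+1} < 2√N`. -/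
theorem rho_upsilon {N : ℕ} (hN : ¬ IsSquare N) (m : ℕ) :
    BinForm.rho (upsilon N m) = upsilon N (m + 1) := by
  obtain ⟨hQ, h1, h2⟩ := cfPQ_invariant hN m
  obtain ⟨hQ₁, h3, h4⟩ := cfPQ_invariant hN (m + 1)
  have h5 := cfPQ_succ_fst_mem hN hQ₁
  have hQ' : (0 : ℝ) < (cfPQ N (m + 1)).2 := by exact_mod_cast hQ₁
  have hN0 : 0 < N := Nat.pos_of_ne_zero (by rintro rfl; exact hN ⟨0, rfl⟩)
  have hsq : ¬ IsSquare (4 * N : ℤ) := by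
    rintro ⟨k, hk⟩
    apply IsNormBasis.abs_ne_sqrt hN (k / 2)
    have h2 : Even k := by
      have : Even (k * k) := hk ▸ ⟨2 * N, by ring⟩
      rcases Int.even_mul.mp this with h | h <;> exact h
    obtain ⟨j, rfl⟩ := h2
    have : (j + j) / 2 = j := by omega
    rw [this, ← Real.sqrt_sq_eq_abs]
    congr 1
    have : j ^ 2 = (N : ℤ) := by linarith
    exact_mod_cast this
  have hc : (-1 : ℤ) ^ (m + 1) * (cfPQ N (m + 1)).2 ≠ 0 :=
    mul_ne_zero (pow_ne_zero _ (by norm_num)) hQ₁.ne'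
  have h1' : ((-1 : ℤ) ^ (m + 1)) ^ 2 = 1 := by rw [← pow_mul, mul_comm, pow_mul]; simp
  have hr := BinForm.redResidue_unique (4 * N) (2 * (cfPQ N (m + 1)).1)
    ((-1) ^ (m + 1) * (cfPQ N (m + 1)).2) (2 * (cfPQ N (m + 1 + 1)).1) hc (by positivity) hsq
    (by
      rw [BinForm.IsRedResidue, sqrt_four_mul, abs_neg_one_pow_mul_cast, abs_of_pos hQ']
      refine ⟨⟨(-1) ^ (m + 1) * cfA N (m + 1), ?_⟩, fun h => ?_, fun _ => ?_⟩
      · rw [cfPQ_succ_fst N (m + 1)]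
        linear_combination -2 * (cfPQ N (m + 1)).2 * cfA N (m + 1) * h1'
      · linarith [(abs_lt.mp h3).1]
      · push_cast
        constructor <;> linarith)
  rw [BinForm.rho, disc_upsilon hN]
  simp only [upsilon]
  rw [← hr]
  congr 1
  refine Int.ediv_eq_of_eq_mul_right (mul_ne_zero four_ne_zero hc) ?_
  rw [pow_succ _ (m + 1)]
  linear_combination 4 * h4 + 4 * (cfPQ N (m + 1)).2 * (cfPQ N (m + 1 + 1)).2 * h1'

theorem iterate_rho_upsilon {N : ℕ} (hN : ¬ IsSquare N) (k : ℕ) :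
    BinForm.rho^[k] (upsilon N 0) = upsilon N k := by
  induction k with
  | zero => rfl
  | succ k ih => rw [Function.iterate_succ_apply', ih, rho_upsilon hN]

theorem isNormBasis_upsilon_zero (N : ℕ) :
    IsNormBasis (upsilon N 0) (1 : ℤ√(N : ℤ)) ⟨(cfPQ N 1).1, 1⟩ := by
  refine ⟨by simp, by simp [upsilon, cfPQ], by simp [upsilon], ?_⟩
  simp only [upsilon, cfPQ_succ_snd]
  simp [cfPQ]

/-- The principal cycle with its distances: the first basis elements measure the distances of the
forms from the unit form. -/
theorem exists_isNormBasis_upsilon {N : ℕ} (hN : ¬ IsSquare N) (k : ℕ) :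
    ∃ α β : ℤ√(N : ℤ), IsNormBasis (upsilon N k) α β ∧
      (upsilon N 0).infraDist k = logRatio α ∧ (upsilon N 0).infraDist (k + 1) = logRatio β := by
  obtain ⟨α, β, h, hd, -⟩ := (isNormBasis_upsilon_zero N).iterate_rho hN k
  rw [logRatio_one, sub_zero] at hd
  refine ⟨α, β, iterate_rho_upsilon hN k ▸ h, hd, ?_⟩
  rw [BinForm.infraDist, Finset.sum_range_succ, ← BinForm.infraDist, hd, h.stepDist_eq hN]
  ring

theorem infraDist_upsilon_succ {N : ℕ} (hN : ¬ IsSquare N) (k : ℕ) :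
    (upsilon N 0).infraDist (k + 1) = (upsilon N 0).infraDist k + (upsilon N k).stepDist := by
  rw [BinForm.infraDist, Finset.sum_range_succ, ← BinForm.infraDist, iterate_rho_upsilon hN]

/-- The lower bound, from `b ≥ 1`, makes the distances unbounded. The upper one uses that the
positive integer `4N - b²` is at least 1, and serves to bound the regulator. -/
theorem stepDist_upsilon_bounds {N : ℕ} (hN : ¬ IsSquare N) (k : ℕ) :
    1 / 2 * Real.log (1 + 1 / √(N : ℝ)) ≤ (upsilon N k).stepDist ∧
      (upsilon N k).stepDist ≤ 2 * N := by
  obtain ⟨α, β, h, -⟩ := exists_isNormBasis_upsilon hN k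
  obtain ⟨-, hb0, hb1, -⟩ := h.isReduced_bounds (isReduced_upsilon hN k)
  have hw := sq_sqrt_natCast N
  have hw0 : 0 < √(N : ℝ) := by linarith
  set b : ℝ := ((upsilon N k).b : ℝ) with hb
  have hb2 : 1 ≤ b := by
    have : 0 < (upsilon N k).b := by rw [hb] at hb0; exact_mod_cast hb0
    rw [hb]; exact_mod_cast this
  have hgap : 0 < 2 * √(N : ℝ) - b := by linarith
  rw [BinForm.stepDist, h.sqrt_disc, ← hb, abs_div, abs_of_pos (by linarith), abs_sub_comm,
    abs_of_pos hgap]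
  constructor
  · gcongr
    rw [le_div_iff₀ hgap, add_mul, one_mul, div_mul_eq_mul_div, one_mul]
    have : (2 * √(N : ℝ) - b) / √(N : ℝ) ≤ 2 := by
      rw [div_le_iff₀ hw0]; linarith
    linarith
  · have h4 : 1 ≤ 4 * (N : ℝ) - b ^ 2 := by
      have h1 : b ^ 2 < 4 * N := by nlinarith
      have h2 : (upsilon N k).b ^ 2 < 4 * N := by rw [hb] at h1; exact_mod_cast h1
      have h3 : (upsilon N k).b ^ 2 + 1 ≤ 4 * N := h2
      have : b ^ 2 + 1 ≤ 4 * N := by rw [hb]; exact_mod_cast h3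
      linarith
    have h5 : (b + 2 * √(N : ℝ)) / (2 * √(N : ℝ) - b) ≤ (4 * √(N : ℝ)) ^ 2 := by
      rw [div_le_iff₀ hgap]
      have h6 : 1 ≤ (2 * √(N : ℝ) - b) * (2 * √(N : ℝ) + b) := by nlinarith
      calc b + 2 * √(N : ℝ) ≤ (b + 2 * √(N : ℝ)) * ((2 * √(N : ℝ) - b) * (2 * √(N : ℝ) + b)) :=
            le_mul_of_one_le_right (by linarith) h6
        _ = (2 * √(N : ℝ) + b) ^ 2 * (2 * √(N : ℝ) - b) := by ring
        _ ≤ (4 * √(N : ℝ)) ^ 2 * (2 * √(N : ℝ) - b) := by gcongr; linarith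
    have h7 := Real.log_le_log (by positivity) h5
    have h8 : Real.log ((4 * √(N : ℝ)) ^ 2) ≤ 4 * N := by
      rw [Real.log_pow, show 4 * √(N : ℝ) = 2 * (2 * √(N : ℝ)) by ring,
        Real.log_mul two_ne_zero (by positivity)]
      have h9 := Real.log_le_sub_one_of_pos (x := 2 * √(N : ℝ)) (by positivity)
      have := Real.log_le_sub_one_of_pos (x := 2) two_pos
      have h10 : (1 : ℝ) ≤ N := by
        have : N ≠ 0 := by rintro rfl; exact hN ⟨0, rfl⟩
        exact_mod_cast Nat.one_le_iff_ne_zero.mpr this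
      push_cast
      nlinarith [sq_nonneg (√(N : ℝ) - 1)]
    linarith

/-! ### Reduced forms and minima of the lattice. -/

namespace IsNormBasis

open BinForm

variable {N : ℕ} {F : BinForm} {α β : ℤ√(N : ℤ)}

theorem abs_lt_of_isReduced (h : IsNormBasis F α β) (hN : ¬ IsSquare N) (hr : F.IsReduced) :
    |qEmb α| < |qEmb β| ∧ |qConj β| < |qConj α| := by
  obtain ⟨-, hb0, hb1, h1, h2⟩ := h.isReduced_bounds hr
  have ha : 0 < |(F.a : ℝ)| := abs_pos.mpr (by exact_mod_cast h.a_ne_zero hN)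
  have h3 := h.abs_a_mul_abs_qEmb
  have h4 := h.abs_a_mul_abs_qConj
  have hα := abs_pos.mpr (qEmb_ne_zero hN h.left_ne_zero)
  have hα' := abs_pos.mpr (qConj_ne_zero hN h.left_ne_zero)
  have hw0 := Real.sqrt_nonneg (N : ℝ)
  constructor
  · refine lt_of_mul_lt_mul_left (a := 2 * |(F.a : ℝ)|) ?_ (by positivity)
    rw [h3, abs_of_pos (by linarith : 0 < (F.b : ℝ) + 2 * √(N : ℝ))]
    exact mul_lt_mul_of_pos_right h1 hα
  · refine lt_of_mul_lt_mul_left (a := 2 * |(F.a : ℝ)|) ?_ (by positivity)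
    rw [h4, abs_of_neg (by linarith : (F.b : ℝ) - 2 * √(N : ℝ) < 0)]
    exact mul_lt_mul_of_pos_right (by linarith) hα'

theorem logRatio_lt_of_isReduced (h : IsNormBasis F α β) (hN : ¬ IsSquare N)
    (hr : F.IsReduced) : logRatio α < logRatio β :=
  logRatio_lt_of_abs hN h.left_ne_zero h.right_ne_zero (h.abs_lt_of_isReduced hN hr).1.le
    (h.abs_lt_of_isReduced hN hr).2

theorem eq_smul_add_smul (h : IsNormBasis F α β) (ω : ℤ√(N : ℤ)) :
    ∃ x y : ℤ, qEmb ω = x * qEmb α + y * qEmb β ∧ qConj ω = x * qConj α + y * qConj β ∧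
      ω.re = x * α.re + y * β.re ∧ ω.im = x * α.im + y * β.im := by
  have h1 : ω.re = (ω.re * β.im - ω.im * β.re) * α.re + (ω.im * α.re - ω.re * α.im) * β.re := by
    linear_combination -ω.re * h.det
  have h2 : ω.im = (ω.re * β.im - ω.im * β.re) * α.im + (ω.im * α.re - ω.re * α.im) * β.im := by
    linear_combination -ω.im * h.det
  set x := ω.re * β.im - ω.im * β.re
  set y := ω.im * α.re - ω.re * α.im
  have h1' : (ω.re : ℝ) = x * α.re + y * β.re := by exact_mod_cast h1
  have h2' : (ω.im : ℝ) = x * α.im + y * β.im := by exact_mod_cast h2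
  refine ⟨x, y, ?_, ?_, h1, h2⟩
  · simp only [qEmb, h1', h2']; ring
  · simp only [qConj, h1', h2']; ring

theorem _root_.abs_le_abs_add_of_mul_nonneg {u v : ℝ} (h : 0 ≤ u * v) : |v| ≤ |u + v| := by
  refine sq_le_sq.mp ?_
  nlinarith [sq_nonneg u]

/-- The basis elements of a reduced form are neighbouring minima of `ℤ√N`. -/
theorem abs_qEmb_le_or_abs_qConj_le (h : IsNormBasis F α β)
    (hr : F.IsReduced) {ω : ℤ√(N : ℤ)} (hω : ω ≠ 0) :
    |qEmb β| ≤ |qEmb ω| ∨ |qConj α| ≤ |qConj ω| := by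
  obtain ⟨-, hb0, hb1, -, -⟩ := h.isReduced_bounds hr
  obtain ⟨x, y, h1, h2, h3, h4⟩ := h.eq_smul_add_smul ω
  -- Since `ac < 0`, the terms of `ω = xα + yβ` with `xy ≠ 0` agree in sign in exactly one of the
  -- two embeddings; there they cannot cancel.
  have hac : (qEmb α * qEmb β) * (qConj α * qConj β) < 0 := by
    have h5 := h.two_mul_qConj_mul_qEmb
    have h6 := h.two_mul_qEmb_mul_qConj
    have : 4 * ((qEmb α * qEmb β) * (qConj α * qConj β)) =
        (2 * (qConj α * qEmb β)) * (2 * (qEmb α * qConj β)) := by ring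
    rw [h5, h6] at this
    nlinarith [Real.sqrt_nonneg (N : ℝ)]
  rw [h1, h2]
  by_cases hy : y = 0
  · right
    have hx : x ≠ 0 := by
      rintro rfl
      exact hω (Zsqrtd.ext (by simpa [hy] using h3) (by simpa [hy] using h4))
    have : (1 : ℝ) ≤ |(x : ℝ)| := by exact_mod_cast Int.one_le_abs hx
    rw [hy, Int.cast_zero, zero_mul, add_zero, abs_mul]
    exact le_mul_of_one_le_left (abs_nonneg _) this
  have hy1 : (1 : ℝ) ≤ |(y : ℝ)| := by exact_mod_cast Int.one_le_abs hy
  by_cases hx : x = 0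
  · left
    rw [hx, Int.cast_zero, zero_mul, zero_add, abs_mul]
    exact le_mul_of_one_le_left (abs_nonneg _) hy1
  have hx1 : (1 : ℝ) ≤ |(x : ℝ)| := by exact_mod_cast Int.one_le_abs hx
  by_cases hs : 0 ≤ (x * qEmb α) * (y * qEmb β)
  · left
    refine le_trans ?_ (abs_le_abs_add_of_mul_nonneg hs)
    rw [abs_mul]
    exact le_mul_of_one_le_left (abs_nonneg _) hy1
  · right
    have hs' : 0 ≤ (y * qConj β) * (x * qConj α) := by
      by_contra! hneg
      have h7 := mul_pos_of_neg_of_neg (not_le.mp hs) hneg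
      have h8 : (x * qEmb α) * (y * qEmb β) * ((y * qConj β) * (x * qConj α)) =
        ((x : ℝ) * y) ^ 2 * ((qEmb α * qEmb β) * (qConj α * qConj β)) := by ring
      rw [h8] at h7
      nlinarith [sq_nonneg ((x : ℝ) * y)]
    rw [add_comm]
    refine le_trans ?_ (abs_le_abs_add_of_mul_nonneg hs')
    rw [abs_mul]
    exact le_mul_of_one_le_left (abs_nonneg _) hx1

theorem neg (h : IsNormBasis F α β) : IsNormBasis F (-α) (-β) := by
  refine ⟨?_, ?_, ?_, ?_⟩
  · simpa using h.det
  · simpa using h.a_eq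
  · simpa using h.b_eq
  · simpa using h.c_eq

/-- The element `α` determines `a`, and `b` modulo `2a`; reducedness confines `b` to an open
interval of length `2|a|`. -/
theorem eq_of_left_eq {F' : BinForm} {β' : ℤ√(N : ℤ)} (h : IsNormBasis F α β)
    (h' : IsNormBasis F' α β') (hN : ¬ IsSquare N) (hr : F.IsReduced) (hr' : F'.IsReduced) :
    F = F' := by
  have ha : F.a = F'.a := h.a_eq.trans h'.a_eq.symm
  refine h.eq_of_b_eq h' hN ha ?_
  have hdvd : 2 * F.a ∣ F.b - F'.b := by
    refine ⟨β.re * β'.im - β.im * β'.re, ?_⟩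
    rw [h.a_eq, h.b_eq, h'.b_eq]
    linear_combination -2 * (α.re * β.re - N * α.im * β.im) * h'.det +
      2 * (α.re * β'.re - N * α.im * β'.im) * h.det
  have h1 := h.isReduced_bounds hr
  have h2 := h'.isReduced_bounds hr'
  rw [← ha] at h2
  have h3 : |(F.b : ℝ) - F'.b| < 2 * |(F.a : ℝ)| := by
    rw [abs_lt]; constructor <;> linarith
  have h4 : |F.b - F'.b| < |2 * F.a| := by
    rw [abs_mul, abs_two]; exact_mod_cast h3
  have := Int.eq_zero_of_abs_lt_dvd ((abs_dvd _ _).mpr hdvd) h4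
  linarith

/-- A reduced form whose distance lies in the window of a form `F` is `F` itself. -/
theorem eq_of_logRatio_mem {G : BinForm} {μ ν : ℤ√(N : ℤ)} (h : IsNormBasis F α β)
    (h' : IsNormBasis G μ ν) (hN : ¬ IsSquare N) (hr : F.IsReduced) (hr' : G.IsReduced)
    (h1 : logRatio α ≤ logRatio μ) (h2 : logRatio μ < logRatio β) :
    G = F ∧ logRatio μ = logRatio α := by
  by_cases heq : |qEmb μ| = |qEmb α|
  · rcases eq_or_eq_neg_of_abs_qEmb_eq hN heq with rfl | rfl
    · exact ⟨h'.eq_of_left_eq h hN hr' hr, rfl⟩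
    · exact ⟨h'.eq_of_left_eq h.neg hN hr' hr, by simp⟩
  exfalso
  have hα := h.left_ne_zero
  have hβ := h.right_ne_zero
  have hμ := h'.left_ne_zero
  have hmin : ∀ ω : ℤ√(N : ℤ), ω ≠ 0 → |qEmb μ| ≤ |qEmb ω| ∨ |qConj μ| ≤ |qConj ω| :=
    fun ω hω => (h'.abs_qEmb_le_or_abs_qConj_le hr' hω).imp_left
      ((h'.abs_lt_of_isReduced hN hr').1.le.trans)
  -- The minimum property of `(α, β)` is applied to `μ`, then that of `μ` to `β` or `α`. The outcome
  -- is `μ = ±β` or `μ = ±α`, excluded by `h2` and `heq`.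
  rcases h.abs_qEmb_le_or_abs_qConj_le hr hμ with h3 | h3
  · have h4 : |qConj β| < |qConj μ| := by
      by_contra! h5
      exact absurd (logRatio_le_of_abs hN hβ hμ h3 h5) (not_le.mpr h2)
    rcases hmin β hβ with h5 | h5
    · rcases eq_or_eq_neg_of_abs_qEmb_eq hN (le_antisymm h5 h3) with rfl | rfl
      · exact lt_irrefl _ h2
      · simp at h2
    · exact absurd h5 (not_le.mpr h4)
  · have h4 : |qEmb α| < |qEmb μ| := by
      by_contra! h5
      have h6 : |qEmb μ| < |qEmb α| := lt_of_le_of_ne h5 heq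
      have h7 := Real.log_lt_log (abs_pos.mpr (qEmb_ne_zero hN hμ)) h6
      have h8 := Real.log_le_log (abs_pos.mpr (qConj_ne_zero hN hα)) h3
      rw [logRatio_eq hN hα, logRatio_eq hN hμ] at h1
      linarith
    rcases hmin α hα with h5 | h5
    · exact absurd h5 (not_le.mpr h4)
    · have hc : |qConj μ| = |qConj α| := le_antisymm h5 h3
      rcases abs_eq_abs.mp hc with h6 | h6
      · refine qConj_ne_zero hN (α := μ - α) (fun h0 => ?_) (by rw [qConj_sub, h6, sub_self])
        exact heq (by rw [sub_eq_zero.mp h0])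
      · refine qConj_ne_zero hN (α := μ + α) (fun h0 => ?_)
          (by rw [qConj_add, h6, neg_add_cancel])
        exact heq (by rw [eq_neg_of_add_eq_zero_left h0, qEmb_neg, abs_neg])

end IsNormBasis

/-! ### Distances along the principal cycle. -/

theorem natCast_pos_of_not_isSquare {N : ℕ} (hN : ¬ IsSquare N) : 1 ≤ N :=
  Nat.one_le_iff_ne_zero.mpr (by rintro rfl; exact hN ⟨0, rfl⟩)

theorem strictMono_infraDist_upsilon {N : ℕ} (hN : ¬ IsSquare N) :
    StrictMono (upsilon N 0).infraDist := by
  refine strictMono_nat_of_lt_succ fun k => ?_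
  obtain ⟨α, β, h, h1, h2⟩ := exists_isNormBasis_upsilon hN k
  rw [h1, h2]
  exact h.logRatio_lt_of_isReduced hN (isReduced_upsilon hN k)

theorem exists_lt_infraDist_upsilon {N : ℕ} (hN : ¬ IsSquare N) (x : ℝ) :
    ∃ k, x < (upsilon N 0).infraDist k := by
  have hN1 := natCast_pos_of_not_isSquare hN
  have hw : 0 < √(N : ℝ) := Real.sqrt_pos.mpr (by exact_mod_cast hN1)
  set c := 1 / 2 * Real.log (1 + 1 / √(N : ℝ)) with hc
  have hc0 : 0 < c := by
    have : 0 < 1 / √(N : ℝ) := by positivity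
    exact mul_pos (by norm_num) (Real.log_pos (by linarith))
  have hk : ∀ k : ℕ, k * c ≤ (upsilon N 0).infraDist k := by
    intro k
    induction k with
    | zero => simp [BinForm.infraDist]
    | succ k ih =>
      rw [infraDist_upsilon_succ hN]
      have := (stepDist_upsilon_bounds hN k).1
      push_cast
      linarith
  obtain ⟨k, hk'⟩ := exists_nat_gt (x / c)
  exact ⟨k, ((div_lt_iff₀ hc0).mp hk').trans_le (hk k)⟩

/-- A reduced form with a basis of nonnegative logarithmic ratio lies on the principal cycle, at
the distance given by that ratio. -/
theorem IsNormBasis.exists_eq_upsilon {N : ℕ} {G : BinForm} {μ ν : ℤ√(N : ℤ)}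
    (h : IsNormBasis G μ ν) (hN : ¬ IsSquare N) (hr : G.IsReduced) (h0 : 0 ≤ logRatio μ) :
    ∃ k, G = upsilon N k ∧ logRatio μ = (upsilon N 0).infraDist k := by
  classical
  have hex := exists_lt_infraDist_upsilon hN (logRatio μ)
  -- The first index whose distance exceeds `logRatio μ` is not 0, as the distance at 0 is 0; its
  -- predecessor is the index sought.
  obtain ⟨k, hk⟩ : ∃ k, Nat.find hex = k + 1 := by
    refine Nat.exists_eq_succ_of_ne_zero fun hz => ?_
    have := Nat.find_spec hex
    rw [hz] at this
    simp only [BinForm.infraDist, Finset.range_zero, Finset.sum_empty] at this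
    linarith
  have h1 := Nat.find_spec hex
  have h2 := not_lt.mp (Nat.find_min hex (m := k) (by omega))
  rw [hk] at h1
  obtain ⟨α, β, hb, hα, hβ⟩ := exists_isNormBasis_upsilon hN k
  rw [hβ] at h1
  rw [hα] at h2
  exact ⟨k, hα ▸ hb.eq_of_logRatio_mem h hN (isReduced_upsilon hN k) hr h2 h1⟩

/-! ### Giant steps. -/

/-- The value `d` is left arbitrary: its deviation from `logRatio α` simply doubles, so the lower
bound also serves the start with `d` ahead of the form. -/
theorem IsNormBasis.giantSquare_spec {N : ℕ} {F : BinForm} {α β : ℤ√(N : ℤ)}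
    (h : IsNormBasis F α β) (hN : ¬ IsSquare N) (hr : F.IsReduced) {w : ℤ × ℤ × ℤ}
    (hw : F.a * w.1 + F.a * w.2.1 + BinForm.beta F F * w.2.2 =
      (Int.gcd F.a (Int.gcd F.a (BinForm.beta F F)) : ℤ)) (d : ℝ) :
    (giantSquare w (F, d)).1.IsReduced ∧
      (∃ α' β' : ℤ√(N : ℤ), IsNormBasis (giantSquare w (F, d)).1 α' β' ∧
        (giantSquare w (F, d)).2 - logRatio α' = 2 * (d - logRatio α)) ∧
      2 * d - 2 * Real.log (4 * N) < (giantSquare w (F, d)).2 := by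
  obtain ⟨α₁, β₁, h₁, hd₁, hle⟩ := h.gaussComp_self hN hw
  have hred := h₁.isReduced_iterate_redCount hN
  obtain ⟨α₂, β₂, h₂, hd₂, -⟩ := h₁.iterate_rho hN (F.gaussComp F w).redCount
  have hlow := h₁.neg_log_le_infraDist hN hred
  refine ⟨hred, ⟨α₂, β₂, h₂, ?_⟩, ?_⟩
  · simp only [giantSquare]
    rw [hd₂, hd₁]; ring
  · simp only [giantSquare]
    have hN1 : (1 : ℝ) ≤ N := by exact_mod_cast natCast_pos_of_not_isSquare hN
    have hsq := sq_sqrt_natCast N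
    have h1 : √(N : ℝ) ≤ N := Real.sqrt_le_iff.mpr ⟨by positivity, by nlinarith⟩
    have h2 : |((F.gaussComp F w).a : ℝ)| ≤ (F.a : ℝ) ^ 2 := by exact_mod_cast hle
    have h3 : (F.a : ℝ) ^ 2 < 4 * N := by
      have := (h.isReduced_bounds hr).1
      rw [← sq_abs]
      nlinarith [abs_nonneg (F.a : ℝ), Real.sqrt_nonneg (N : ℝ)]
    -- The left side is below `8N + 2N`; the square on the right is the source of the factor 2 in `2
    -- log (4N)`.
    have h4 : 2 * |((F.gaussComp F w).a : ℝ)| + 2 * √(N : ℝ) < (4 * N) ^ 2 := by nlinarith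
    have h5 := Real.log_lt_log (by positivity) h4
    rw [Real.log_pow] at h5
    push_cast at h5
    linarith

/-- With `L = log (4N)`, the bound reproduces itself because `2(2^i + 2L) - 2L = 2^(i+1) + 2L`. -/
theorem giantState_spec {N : ℕ} (hN : ¬ IsSquare N) {bez : ℕ → ℤ → ℤ → ℤ → ℤ × ℤ × ℤ}
    (hbez : IsBezoutRule bez) {S₀ : BinForm × ℝ} {α₀ β₀ : ℤ√(N : ℤ)}
    (h₀ : IsNormBasis S₀.1 α₀ β₀) (hr : S₀.1.IsReduced)
    (hd : 2 * Real.log (4 * N) + 1 ≤ S₀.2) (i : ℕ) :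
    (giantState bez S₀ i).1.IsReduced ∧
      (∃ α β : ℤ√(N : ℤ), IsNormBasis (giantState bez S₀ i).1 α β ∧
        (giantState bez S₀ i).2 - logRatio α = 2 ^ i * (S₀.2 - logRatio α₀)) ∧
      2 ^ i + 2 * Real.log (4 * N) ≤ (giantState bez S₀ i).2 ∧
      (1 ≤ i → 2 ^ i + 2 * Real.log (4 * N) < (giantState bez S₀ i).2) := by
  induction i with
  | zero =>
    refine ⟨hr, ⟨α₀, β₀, h₀, ?_⟩, ?_, fun h => absurd h (by norm_num)⟩
    · simp [giantState]
    · simp only [giantState, pow_zero]; linarith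
  | succ i ih =>
    obtain ⟨hr, ⟨α, β, h, hα⟩, hle, -⟩ := ih
    obtain ⟨h1, ⟨α', β', h', hd'⟩, h3⟩ := h.giantSquare_spec hN hr (hbez i _ _ _)
      (giantState bez S₀ i).2
    have hlt : 2 ^ (i + 1) + 2 * Real.log (4 * N) < (giantState bez S₀ (i + 1)).2 := by
      simp only [giantState]
      rw [pow_succ]
      linarith
    refine ⟨h1, ⟨α', β', h', ?_⟩, hlt.le, fun _ => hlt⟩
    rw [pow_succ]
    simp only [giantState]
    linear_combination hd' + 2 * hα

theorem startState_spec {N : ℕ} (hN : ¬ IsSquare N) :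
    (∃ k, startState N = (upsilon N k, (upsilon N 0).infraDist k)) ∧
      2 * Real.log (4 * N) + 1 ≤ (startState N).2 := by
  refine ⟨⟨_, by rw [startState]; simp only [iterate_rho_upsilon hN]; rfl⟩, ?_⟩
  obtain ⟨k, hk⟩ := exists_lt_infraDist_upsilon hN (2 * Real.log (4 * N) + 1)
  exact Nat.sInf_mem (s := {k | 2 * Real.log (4 * N) + 1 ≤ (upsilon N 0).infraDist k}) ⟨k, hk.le⟩

theorem startStateAhead_spec {N : ℕ} (hN : ¬ IsSquare N) :
    (∃ k, (startStateAhead N).1 = upsilon N k) ∧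
      2 * Real.log (4 * N) + 1 ≤ (startStateAhead N).2 := by
  refine ⟨⟨_, by rw [startStateAhead]; exact iterate_rho_upsilon hN _⟩, ?_⟩
  obtain ⟨k, hk⟩ := exists_lt_infraDist_upsilon hN (2 * Real.log (4 * N) + 1)
  exact Nat.sInf_mem (s := {k | 2 * Real.log (4 * N) + 1 ≤ (upsilon N 0).infraDist (k + 1)})
    ⟨k, (hk.trans (strictMono_infraDist_upsilon hN k.lt_succ_self)).le⟩

/-! ### A polynomial upper bound for `R⁺(N)`. -/

/-- Two bases for the same form differ by a unit of norm one. -/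
theorem IsNormBasis.exists_unit {N : ℕ} {F : BinForm} {α β α' β' : ℤ√(N : ℤ)}
    (h : IsNormBasis F α β) (h' : IsNormBasis F α' β') (hN : ¬ IsSquare N) :
    ∃ ε : ℤ√(N : ℤ), ε.re ^ 2 - N * ε.im ^ 2 = 1 ∧
      qEmb ε * qEmb α = qEmb α' ∧ qConj ε * qConj α = qConj α' := by
  have ha := h.a_eq
  have hb := h.b_eq
  have hc := h.c_eq
  rw [h'.a_eq] at ha
  rw [h'.b_eq] at hb
  rw [h'.c_eq] at hc
  have hE : qEmb β' * qEmb α = qEmb β * qEmb α' := by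
    have h1 := h.two_mul_qConj_mul_qEmb
    have h2 := h'.two_mul_qConj_mul_qEmb
    have h3 := h.a_cast
    rw [h'.a_cast] at h3
    refine mul_left_cancel₀ (qConj_ne_zero hN h'.left_ne_zero) ?_
    linear_combination qEmb α / 2 * (h2 - h1) - qEmb β * h3
  have hC : qConj β' * qConj α = qConj β * qConj α' := by
    have h1 := h.two_mul_qEmb_mul_qConj
    have h2 := h'.two_mul_qEmb_mul_qConj
    have h3 := h.a_cast
    rw [h'.a_cast] at h3
    refine mul_left_cancel₀ (qEmb_ne_zero hN h'.left_ne_zero) ?_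
    linear_combination qConj α / 2 * (h2 - h1) - qConj β * h3
  have h1 : β.im * qEmb α - α.im * qEmb β = 1 := by
    simp only [qEmb]; linear_combination h.det_cast
  have h2 : β.im * qConj α - α.im * qConj β = 1 := by
    simp only [qConj]; linear_combination h.det_cast
  -- The unit is `α'/α = β'/β`; multiplying it by `β.im • α - α.im • β = 1` gives this integral
  -- expression.
  refine ⟨⟨β.im * α'.re - α.im * β'.re, β.im * α'.im - α.im * β'.im⟩, ?_, ?_, ?_⟩
  · simp only
    linear_combination β.im ^ 2 * ha - β.im * α.im * hb + α.im ^ 2 * hc +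
      (α.re * β.im - α.im * β.re + 1) * h.det
  · have h3 : qEmb (⟨β.im * α'.re - α.im * β'.re, β.im * α'.im - α.im * β'.im⟩ : ℤ√(N : ℤ)) =
        β.im * qEmb α' - α.im * qEmb β' := by
      simp only [qEmb]; push_cast; ring
    rw [h3]
    linear_combination qEmb α' * h1 - α.im * hE
  · have h3 : qConj (⟨β.im * α'.re - α.im * β'.re, β.im * α'.im - α.im * β'.im⟩ : ℤ√(N : ℤ)) =
        β.im * qConj α' - α.im * qConj β' := by
      simp only [qConj]; push_cast; ring
    rw [h3]
    linear_combination qConj α' * h2 - α.im * hC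

theorem infraDist_upsilon_le {N : ℕ} (hN : ¬ IsSquare N) (k : ℕ) :
    (upsilon N 0).infraDist k ≤ k * (2 * N) := by
  induction k with
  | zero => simp [BinForm.infraDist]
  | succ k ih =>
    rw [infraDist_upsilon_succ hN]
    have := (stepDist_upsilon_bounds hN k).2
    push_cast
    linarith

theorem exists_upsilon_eq {N : ℕ} (hN : ¬ IsSquare N) :
    ∃ i j : ℕ, i < j ∧ j ≤ (4 * N + 1) * (2 * N + 1) ∧ upsilon N i = upsilon N j := by
  have hN1 : (1 : ℝ) ≤ N := by exact_mod_cast natCast_pos_of_not_isSquare hN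
  have hsq := sq_sqrt_natCast N
  have hwN : √(N : ℝ) ≤ N := Real.sqrt_le_iff.mpr ⟨by positivity, by nlinarith⟩
  -- Reducedness puts `(a, b)` in this box, and the discriminant then determines `c`.
  let t : Finset (ℤ × ℤ) := Finset.Icc (-(2 * N : ℤ)) (2 * N) ×ˢ Finset.Icc (0 : ℤ) (2 * N)
  have hmaps : Set.MapsTo (fun k => ((upsilon N k).a, (upsilon N k).b))
      (Finset.range ((4 * N + 1) * (2 * N + 1) + 1) : Set ℕ) t := by
    intro k _
    obtain ⟨α, β, h, -⟩ := exists_isNormBasis_upsilon hN k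
    obtain ⟨h1, h2, h3, -⟩ := h.isReduced_bounds (isReduced_upsilon hN k)
    have h4 := abs_le.mp (h1.le.trans (by linarith : 2 * √(N : ℝ) ≤ 2 * N))
    have h5 : ((upsilon N k).b : ℝ) ≤ 2 * N := by linarith
    simp only [t, Finset.coe_product, Set.mem_prod, Finset.coe_Icc, Set.mem_Icc]
    exact ⟨⟨by exact_mod_cast h4.1, by exact_mod_cast h4.2⟩, by exact_mod_cast h2.le,
      by exact_mod_cast h5⟩
  have hcard : t.card < (Finset.range ((4 * N + 1) * (2 * N + 1) + 1)).card := by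
    have h1 : (2 * (N : ℤ) + 1 - -(2 * N)).toNat = 4 * N + 1 := by omega
    have h2 : (2 * (N : ℤ) + 1 - 0).toNat = 2 * N + 1 := by omega
    rw [Finset.card_product, Int.card_Icc, Int.card_Icc, h1, h2, Finset.card_range]
    exact Nat.lt_succ_self _
  obtain ⟨i, hi, j, hj, hne, heq⟩ := Finset.exists_ne_map_eq_of_card_lt_of_maps_to hcard hmaps
  have heq' : upsilon N i = upsilon N j := by
    obtain ⟨α, β, h, -⟩ := exists_isNormBasis_upsilon hN i
    obtain ⟨α', β', h', -⟩ := exists_isNormBasis_upsilon hN j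
    exact h.eq_of_b_eq h' hN (congrArg Prod.fst heq) (congrArg Prod.snd heq)
  rw [Finset.mem_range] at hi hj
  rcases lt_or_gt_of_ne hne with hlt | hlt
  · exact ⟨i, j, hlt, by omega, heq'⟩
  · exact ⟨j, i, hlt, by omega, heq'.symm⟩

/-- The fundamental solution is bounded by any unit of norm one outside the unit interval. -/
theorem regPlus_le_log {N : ℕ} (hN : ¬ IsSquare N) {ε : ℤ√(N : ℤ)}
    (hε : ε.re ^ 2 - N * ε.im ^ 2 = 1) (h1 : 1 < |qEmb ε|) :
    regPlus N ≤ Real.log |qEmb ε| := by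
  unfold regPlus
  -- Without a fundamental solution `regPlus` would be its default 0, and the bound is immediate.
  split_ifs with h
  swap
  · exact Real.log_nonneg h1.le
  have hN1 : (1 : ℝ) ≤ N := by exact_mod_cast natCast_pos_of_not_isSquare hN
  have hw0 := Real.sqrt_nonneg (N : ℝ)
  obtain ⟨hx, hy, hmin⟩ := h.choose_spec
  set e := h.choose
  have hprod : |qEmb ε| * |qConj ε| = 1 := by
    rw [← abs_mul, qEmb_mul_qConj, hε]; simp
  have hconj : |qConj ε| < 1 := by
    by_contra! h2
    nlinarith
  have hre : ε.re ≠ 0 := by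
    intro h0
    rw [h0] at hε
    nlinarith [sq_nonneg ε.im]
  have hre1 : (1 : ℝ) ≤ |(ε.re : ℝ)| := by exact_mod_cast Int.one_le_abs hre
  -- The left side is the larger conjugate in absolute value. So `(|ε.re|, |ε.im|)` is a nonnegative
  -- Pell solution of the same size, comparable with the minimal one.
  have hsum : |(ε.re : ℝ)| + |(ε.im : ℝ)| * √(N : ℝ) = |qEmb ε| := by
    have h3 : |(ε.re : ℝ)| + |(ε.im : ℝ)| * √(N : ℝ) = |qEmb ε| ∨
        |(ε.re : ℝ)| + |(ε.im : ℝ)| * √(N : ℝ) = |qConj ε| := by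
      have h4 : |(ε.im : ℝ)| * √(N : ℝ) = |ε.im * √(N : ℝ)| := by
        rw [abs_mul, abs_of_nonneg hw0]
      rw [h4, qEmb, qConj]
      rcases le_total 0 ((ε.re : ℝ) * (ε.im * √(N : ℝ))) with h5 | h5
      · left; exact ((abs_add_eq_add_abs_iff _ _).mpr (mul_nonneg_iff.mp h5)).symm
      · right
        rw [← abs_neg (ε.im * √(N : ℝ)), sub_eq_add_neg]
        exact ((abs_add_eq_add_abs_iff _ _).mpr (mul_nonneg_iff.mp (by linarith))).symm
    refine h3.resolve_right fun h4 => ?_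
    have : 0 ≤ |(ε.im : ℝ)| * √(N : ℝ) := by positivity
    linarith
  have hx1 : 1 < |ε.re| := by
    refine lt_of_le_of_ne (Int.one_le_abs hre) fun h2 => ?_
    have h3 : ε.re ^ 2 = 1 := by rw [← sq_abs, ← h2]; norm_num
    have h4 : ε.im = 0 := by
      rw [h3] at hε
      have h5 : (N : ℤ) * ε.im ^ 2 = 0 := by linarith
      rcases mul_eq_zero.mp h5 with h6 | h6
      · have : (1 : ℤ) ≤ N := by exact_mod_cast natCast_pos_of_not_isSquare hN
        omega
      · exact pow_eq_zero_iff two_ne_zero |>.mp h6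
    have h5 : |(ε.re : ℝ)| = 1 := by exact_mod_cast h2.symm
    rw [h4, h5] at hsum
    simp at hsum
    linarith
  have hle := hmin (b := Pell.Solution₁.mk |ε.re| |ε.im| (by rw [sq_abs, sq_abs]; exact hε))
    (by simpa using hx1)
  rw [Pell.Solution₁.x_mk] at hle
  have hyle : e.y ≤ |ε.im| := by
    by_contra! h2
    have h3 := e.prop
    have h4 : |ε.re| ^ 2 - N * |ε.im| ^ 2 = 1 := by rw [sq_abs, sq_abs]; exact hε
    have h5 : (1 : ℤ) ≤ N := by exact_mod_cast natCast_pos_of_not_isSquare hN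
    have h6 : |ε.im| ^ 2 < e.y ^ 2 := by nlinarith [abs_nonneg ε.im]
    nlinarith
  have hxR : (e.x : ℝ) ≤ |(ε.re : ℝ)| := by exact_mod_cast hle
  have hyR : (e.y : ℝ) ≤ |(ε.im : ℝ)| := by exact_mod_cast hyle
  have hx0 : (0 : ℝ) < e.x := by exact_mod_cast (by omega : 0 < e.x)
  have hy0 : (0 : ℝ) < e.y := by exact_mod_cast hy
  rw [← hsum]
  exact Real.log_le_log (by positivity) (by gcongr)

/-- A repetition on the cycle gives a unit whose logarithm is the difference of two distances. The
three factors are the number of steps, as the size of the box for `(a, b)`, and the maximal step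
`2N`. -/
theorem regPlus_le {N : ℕ} (hN : ¬ IsSquare N) :
    regPlus N ≤ (4 * N + 1) * (2 * N + 1) * (2 * N) := by
  obtain ⟨i, j, hij, hj, heq⟩ := exists_upsilon_eq hN
  obtain ⟨α, β, h, hα, -⟩ := exists_isNormBasis_upsilon hN i
  obtain ⟨α', β', h', hα', -⟩ := exists_isNormBasis_upsilon hN j
  rw [← heq] at h'
  obtain ⟨ε, hε, he, hc⟩ := h.exists_unit h' hN
  have hprod : |qEmb ε| * |qConj ε| = 1 := by
    rw [← abs_mul, qEmb_mul_qConj, hε]; simp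
  have hE0 : |qEmb ε| ≠ 0 := left_ne_zero_of_mul_eq_one hprod
  have hC0 : |qConj ε| ≠ 0 := right_ne_zero_of_mul_eq_one hprod
  have hlog : Real.log |qEmb ε| = logRatio α' - logRatio α := by
    have h0 : Real.log |qEmb ε| + Real.log |qConj ε| = 0 := by
      rw [← Real.log_mul hE0 hC0, hprod, Real.log_one]
    rw [logRatio_eq hN h.left_ne_zero, logRatio_eq hN h'.left_ne_zero, ← he, ← hc, abs_mul,
      abs_mul, Real.log_mul hE0 (abs_ne_zero.mpr (qEmb_ne_zero hN h.left_ne_zero)),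
      Real.log_mul hC0 (abs_ne_zero.mpr (qConj_ne_zero hN h.left_ne_zero))]
    linarith
  have hmono := strictMono_infraDist_upsilon hN
  have hlt := hmono hij
  have h0 : 0 ≤ (upsilon N 0).infraDist i := by
    have := hmono.monotone (Nat.zero_le i)
    simpa [BinForm.infraDist] using this
  have h1 : 1 < |qEmb ε| := by
    refine (Real.log_pos_iff (abs_nonneg _)).mp ?_
    rw [hlog, ← hα, ← hα']
    linarith
  have h2 := infraDist_upsilon_le hN j
  have h3 : (j : ℝ) ≤ (4 * N + 1) * (2 * N + 1) := by exact_mod_cast hj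
  calc regPlus N ≤ Real.log |qEmb ε| := regPlus_le_log hN hε h1
    _ ≤ j * (2 * N) := by rw [hlog, ← hα, ← hα']; linarith
    _ ≤ _ := by gcongr

/-! ### Counting the giant steps. -/

theorem IsInput.nine_le {N : ℕ} (h : IsInput N) : 9 ≤ N := by
  obtain ⟨h1, h2, h3, -⟩ := h
  by_contra! hlt
  interval_cases N <;> revert h2 h3 <;> decide

theorem IsInput.two_lt_log {N : ℕ} (h : IsInput N) : 2 < Real.log N := by
  have h9 := h.nine_le
  rw [Real.lt_log_iff_exp_lt (by positivity)]
  have h5 := Real.exp_one_lt_d9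
  have h6 : Real.exp 2 = Real.exp 1 ^ 2 := by rw [← Real.exp_nat_mul]; norm_num
  have h7 : Real.exp 1 ^ 2 < 9 := by
    have := Real.exp_pos 1
    nlinarith
  have : (9 : ℝ) ≤ N := by exact_mod_cast h9
  linarith

theorem IsInput.target_bounds {N : ℕ} (h : IsInput N) {D : ℝ}
    (hD : D ∈ ({targetDist N, regPlus N / 2, regPlus N / 4} : Set ℝ)) :
    1 < D ∧ D ≤ (N : ℝ) ^ 5 := by
  have hlog := h.two_lt_log
  have h9 : (9 : ℝ) ≤ N := by exact_mod_cast h.nine_le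
  obtain ⟨-, -, -, h4, h5⟩ := h
  -- From `R⁺(N) > (log N)²` and `log N > 2`; even a quarter of the regulator then exceeds 1.
  have hreg : 4 < regPlus N := by nlinarith
  have hup := regPlus_le h4
  have hup' : regPlus N / 2 ≤ (N : ℝ) ^ 5 := by
    have h6 : (4 * (N : ℝ) + 1) * (2 * N + 1) * (2 * N) ≤ (5 * N) * (3 * N) * (2 * N) := by
      gcongr <;> linarith
    have h7 : (15 : ℝ) ≤ N ^ 2 := by nlinarith
    have h8 : (15 : ℝ) * N ^ 3 ≤ N ^ 2 * N ^ 3 := by gcongr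
    nlinarith
  have key : D = regPlus N / 2 ∨ D = regPlus N / 4 := by
    rcases hD with rfl | rfl | rfl
    · unfold targetDist
      split_ifs
      · exact Or.inl rfl
      · exact Or.inr rfl
    · exact Or.inl rfl
    · exact Or.inr rfl
  rcases key with rfl | rfl <;> constructor <;> linarith

theorem giantCount_spec {N : ℕ} (hin : IsInput N) {bez : ℕ → ℤ → ℤ → ℤ → ℤ × ℤ × ℤ}
    (hbez : IsBezoutRule bez) {S₀ : BinForm × ℝ}
    (hS : S₀ ∈ ({startState N, startStateAhead N} : Set (BinForm × ℝ))) {D : ℝ} (hD : 1 < D) :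
    IsLeast {i : ℕ | D < (giantState bez S₀ i).2} (giantCount bez S₀ D) ∧
      (giantCount bez S₀ D : ℤ) ≤ ⌈Real.logb 2 D⌉ := by
  have hN := hin.2.2.2.1
  obtain ⟨k, hk, hd⟩ : ∃ k, S₀.1 = upsilon N k ∧ 2 * Real.log (4 * N) + 1 ≤ S₀.2 := by
    rcases hS with rfl | rfl
    · obtain ⟨⟨k, hk⟩, hd⟩ := startState_spec hN
      exact ⟨k, congrArg Prod.fst hk, hd⟩
    · obtain ⟨⟨k, hk⟩, hd⟩ := startStateAhead_spec hN
      exact ⟨k, hk, hd⟩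
  obtain ⟨α, β, h, -⟩ := exists_isNormBasis_upsilon hN k
  rw [← hk] at h
  have hr : S₀.1.IsReduced := hk ▸ isReduced_upsilon hN k
  have hlog : 0 < Real.logb 2 D := Real.logb_pos one_lt_two hD
  have hceil : 0 < ⌈Real.logb 2 D⌉ := Int.ceil_pos.mpr hlog
  -- At `m = ⌈log₂ D⌉` one has `D ≤ 2^m < 2^m + 2 log (4N) ≤ d_m`.
  obtain ⟨m, hm⟩ := Int.eq_ofNat_of_zero_le hceil.le
  have hmem : D < (giantState bez S₀ m).2 := by
    have h1 := (giantState_spec hN hbez h hr hd m).2.2.1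
    have h2 : Real.logb 2 D ≤ m := by
      have := Int.le_ceil (Real.logb 2 D)
      rw [hm] at this
      exact_mod_cast this
    rw [Real.logb_le_iff_le_rpow one_lt_two (by linarith), Real.rpow_natCast] at h2
    have h3 : 0 < Real.log (4 * N) := by
      have h4 := hin.two_lt_log
      have h5 : (1 : ℝ) ≤ N := by exact_mod_cast natCast_pos_of_not_isSquare hN
      exact Real.log_pos (by linarith)
    linarith
  refine ⟨⟨Nat.sInf_mem ⟨m, hmem⟩, fun i hi => Nat.sInf_le hi⟩, ?_⟩
  rw [hm]
  exact_mod_cast Nat.sInf_le (s := {i : ℕ | D < (giantState bez S₀ i).2}) hmem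

theorem mainTheorem6 :
    -- the distances of the forms `G_i`
    (∀ N : ℕ, IsInput N →
      2 * Real.log (4 * N) + 1 ≤ (startState N).2 ∧
      2 * Real.log (4 * N) + 1 ≤ (startStateAhead N).2 ∧
      ∀ bez : ℕ → ℤ → ℤ → ℤ → ℤ × ℤ × ℤ, IsBezoutRule bez →
        ∀ i : ℕ,
          (giantState bez (startState N) i).1.IsReduced ∧
          (∃ k : ℕ,
            BinForm.rho^[k] (upsilon N 0) = upsilon N k ∧
            (giantState bez (startState N) i).1 = upsilon N k ∧
            (giantState bez (startState N) i).2 = (upsilon N 0).infraDist k) ∧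
          (1 ≤ i → 2 ^ i + 2 * Real.log (4 * N) < (giantState bez (startState N) i).2)) ∧
    -- the loop stops, after at most `⌈log₂ D⌉` giant steps
    (∀ N : ℕ, IsInput N →
      ∀ bez : ℕ → ℤ → ℤ → ℤ → ℤ × ℤ × ℤ, IsBezoutRule bez →
        ∀ S₀ ∈ ({startState N, startStateAhead N} : Set (BinForm × ℝ)),
        ∀ D ∈ ({targetDist N, regPlus N / 2, regPlus N / 4} : Set ℝ),
          IsLeast {i : ℕ | D < (giantState bez S₀ i).2} (giantCount bez S₀ D) ∧
          (giantCount bez S₀ D : ℤ) ≤ ⌈Real.logb 2 D⌉) ∧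
    -- the number of giant steps is `O(ln N)`
    (∃ C : ℝ, ∀ N : ℕ, IsInput N →
      ∀ bez : ℕ → ℤ → ℤ → ℤ → ℤ × ℤ × ℤ, IsBezoutRule bez →
        ∀ S₀ ∈ ({startState N, startStateAhead N} : Set (BinForm × ℝ)),
        ∀ D ∈ ({targetDist N, regPlus N / 2, regPlus N / 4} : Set ℝ),
          (giantCount bez S₀ D : ℝ) ≤ C * Real.log N) := by
  -- Since `D ≤ N^5` and `log 2 > 1/2`, `log₂ D ≤ 10 log N`; the eleventh `log N` absorbs the 1 lost
  -- in the ceiling.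
  refine ⟨fun N hin => ?_, fun N hin bez hbez S₀ hS D hD => ?_, 11,
    fun N hin bez hbez S₀ hS D hD => ?_⟩
  · have hN := hin.2.2.2.1
    obtain ⟨⟨k, hk⟩, hd⟩ := startState_spec hN
    refine ⟨hd, (startStateAhead_spec hN).2, fun bez hbez i => ?_⟩
    obtain ⟨α, β, h, hα, -⟩ := exists_isNormBasis_upsilon hN k
    have h₀ : IsNormBasis (startState N).1 α β := by rw [hk]; exact h
    have hr : (startState N).1.IsReduced := by rw [hk]; exact isReduced_upsilon hN k
    have hdist : (startState N).2 - logRatio α = 0 := by rw [hk, ← hα, sub_self]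
    obtain ⟨h1, ⟨μ, ν, h2, h3⟩, h4, h5⟩ := giantState_spec hN hbez h₀ hr hd i
    rw [hdist, mul_zero, sub_eq_zero] at h3
    have hpos : 0 ≤ logRatio μ := by
      rw [← h3]
      have h6 : (1 : ℝ) ≤ N := by exact_mod_cast natCast_pos_of_not_isSquare hN
      have h7 : 0 ≤ Real.log (4 * N) := Real.log_nonneg (by linarith)
      have h8 : (0 : ℝ) < 2 ^ i := by positivity
      linarith
    obtain ⟨j, h9, h10⟩ := h2.exists_eq_upsilon hN h1 hpos
    exact ⟨h1, ⟨j, iterate_rho_upsilon hN j, h9, h3.trans h10⟩, h5⟩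
  · exact giantCount_spec hin hbez hS (hin.target_bounds hD).1
  · obtain ⟨h1, h2⟩ := hin.target_bounds hD
    have h3 := (giantCount_spec hin hbez hS h1).2
    have h4 : (giantCount bez S₀ D : ℝ) ≤ ⌈Real.logb 2 D⌉ := by exact_mod_cast h3
    have h5 := Int.ceil_lt_add_one (Real.logb 2 D)
    have hlog := hin.two_lt_log
    have h6 : Real.log D ≤ 5 * Real.log N := by
      have := Real.log_le_log (by linarith) h2
      rwa [Real.log_pow] at this
    have h7 : Real.logb 2 D ≤ 10 * Real.log N := by
      have := Real.log_two_gt_d9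
      rw [Real.logb, div_le_iff₀ (by linarith)]
      nlinarith
    linarith
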